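/- Let $(\Omega,\mathcal F,P)$ be a complete probability space, $T>0$, let $Y=(Y_t)_{t\in[0,T]}$ be an $\mathbb R^m$-valued càdlàg process with independent increments and $\xi$ a random variable that is uniform on $[0,1]$ and independent of $Y$. Let $\mathbb F=(\mathcal F_t)_{t\in[0,T]}$, where $\mathcal F_t$ is generated by $(Y_s)_{s\le t}$ and the $P$-null sets, and $\mathbb G=(\mathcal G_t)_{t\in[0,T]}$ with $\mathcal G_t=\sigma(\mathcal F_t,\xi)$. Let $d\ge 1$ and let $S$ be a continuous $\mathbb F$-adapted $\mathbb R^d$-valued process with strictly positive entries, $S^1\equiv 1$ and $S_0=(1,\dots,1)$. Let $K\subset\mathbb R^d$ be a closed convex cone with $K\cap(-K)=\{0\}$ and $\mathbb R^d_+\subset K$, and let $K^*=\{y:\ x\cdot y\ge 0\ \ \forall x\in K\}$. Products and quotients of vectors ($z/s$, $s\odot v$) are componentwise, and $|\cdot|$ is the Euclidean norm. A strategy is a $\mathbb G$-adapted càdlàg $\mathbb R^d$-valued process $B$ which, with the convention $B_{0-}=0$, is $K$-decreasing: $-B_0\in K$ and $B_s-B_t\in K$ for all $0\le s\le t\le T$.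 For $x\in K$ put $\widehat V^{x,B}_t=x+\int_{[0,t]}\frac1{S_s}\,dB_s$ (componentwise pathwise Lebesgue–Stieltjes integral, where $dB$ has the atom $B_0$ at $0$) and $V^{x,B}=S\odot\widehat V^{x,B}$. Let $\mathcal A(x)$ be the set of strategies $B$ with $V^{x,B}_t\in K$ a.s. for all $t\in[0,T]$. Let $\mathrm{Var}_TB=\sum_{i=1}^d\mathrm{Var}_TB^i$, where the total variation on $[0,T]$ of each component is computed with $B^i_{0-}=0$ and so includes $|B^i_0|$; let $\mathrm{Var}^{\mathrm e}_TB=\sup\big(|B_0|+\sum_j|B_{t_j}-B_{t_{j-1}}|\big)$, the supremum being over finite partitions $0=t_0<\dots<t_k=T$, be the total variation of $B$ in the Euclidean norm. For $\varepsilon>0$, an $\varepsilon$-consistent price system is an $\mathbb R^d_+$-valued right-continuous $\mathbb F$-martingale $Z$ such that, for every $t\in[0,T]$, a.s. $Z_t/S_t\in K^*\setminus\{0\}$ and $(Z_t/S_t)\cdot y>\varepsilon\,|Z_t/S_t|\,|y|$ for all $y\in K\setminus\{0\}$. **Theorem.** Suppose that for some $\varepsilon>0$ there exists an $\varepsilon$-consistent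 price system, and let $x\in K$. Then the family of random variables $\{\mathrm{Var}_TB:\ B\in\mathcal A(x)\}$ is tight under $P$: for every $\delta>0$ there is $c<\infty$ with $P(\mathrm{Var}_TB>c)\le\delta$ for all $B\in\mathcal A(x)$. Moreover, for every $\varepsilon>0$, every $\varepsilon$-consistent price system $Z$ with $Z^1_0=1$ a.s. and every $B\in\mathcal A(x)$, with $Q=Z^1_T\,P$, $$\mathbb E_Q\,\mathrm{Var}^{\mathrm e}_TB\ \le\ \frac{\wp(x)}{\varepsilon},\qquad \wp(x)=\inf\{y\in\mathbb R:\ y e_1-x\in K\}\in(-\infty,+\infty],\quad \inf\varnothing=+\infty .$$ -/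

import Mathlib

open Set Filter Topology MeasureTheory ProbabilityTheory
open scoped ENNReal NNReal InnerProductSpace

namespace KabanovModel

/-- The time interval `[0, T]`. -/
abbrev Time (T : ℝ) : Type := Set.Icc (0 : ℝ) T

instance (T : ℝ) : CompactIccSpace (Time T) := ⟨fun {_ _} => isClosed_Icc.isCompact⟩

/-- The initial time `0`. -/
def startTime (T : ℝ) [hT : Fact (0 < T)] : Time T := ⟨0, le_rfl, hT.out.le⟩

/-- The terminal time `T`. -/
def endTime (T : ℝ) [hT : Fact (0 < T)] : Time T := ⟨T, hT.out.le, le_rfl⟩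

/-- A path on `[0, T]` that is right-continuous with left limits (càdlàg, RCLL). -/
def IsRCLL {T : ℝ} {E : Type*} [TopologicalSpace E] (f : Time T → E) : Prop :=
  (∀ t, ContinuousWithinAt f (Ici t) t) ∧ ∀ t, ∃ l, Tendsto f (𝓝[<] t) (𝓝 l)

section Basis

variable {Ω : Type*} [mΩ : MeasurableSpace Ω] {m : ℕ} {T : ℝ}

/-- The standing assumptions on the sources of randomness: `Y` is an `ℝᵐ`-valued RCLL process with
independent increments, and `ξ` is uniform on `[0, 1]` and independent of `Y`. -/
structure IsBasis (P : Measure Ω) (Y : Time T → Ω → EuclideanSpace ℝ (Fin m)) (ξ : Ω → ℝ) :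
    Prop where
  measurable_Y : ∀ t, Measurable (Y t)
  rcll_Y : ∀ᵐ ω ∂P, IsRCLL fun t => Y t ω
  indepIncrements_Y : HasIndepIncrements Y P
  measurable_ξ : Measurable ξ
  uniform_ξ : P.map ξ = volume.restrict (Icc (0 : ℝ) 1)
  indep_ξ_Y : IndepFun ξ (fun ω t => Y t ω) P

/-- The σ-algebra generated by the `P`-null events. -/
abbrev nullSigmaAlgebra (P : Measure Ω) : MeasurableSpace Ω :=
  MeasurableSpace.generateFrom {A | MeasurableSet A ∧ P A = 0}

theorem nullSigmaAlgebra_le (P : Measure Ω) : nullSigmaAlgebra P ≤ mΩ :=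
  MeasurableSpace.generateFrom_le fun _ hA => hA.1

/-- The filtration `𝔽`: `𝓕_t` is generated by `Y_s`, `s ≤ t`, and the null events. -/
noncomputable def filtrationF (P : Measure Ω) (Y : Time T → Ω → EuclideanSpace ℝ (Fin m))
    (hY : ∀ t, Measurable (Y t)) : Filtration (Time T) mΩ :=
  Filtration.natural Y (fun t => (hY t).stronglyMeasurable) ⊔
    Filtration.const (Time T) (nullSigmaAlgebra P) (nullSigmaAlgebra_le P)

/-- The filtration `𝔾`: `𝓖_t` is generated by `𝓕_t` and `ξ`. -/
noncomputable def filtrationG (P : Measure Ω) (Y : Time T → Ω → EuclideanSpace ℝ (Fin m))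
    (hY : ∀ t, Measurable (Y t)) (ξ : Ω → ℝ) (hξ : Measurable ξ) : Filtration (Time T) mΩ :=
  filtrationF P Y hY ⊔
    Filtration.const (Time T) (MeasurableSpace.comap ξ inferInstance) hξ.comap_le

end Basis

section Variation

variable {T : ℝ} [Fact (0 < T)] {d : ℕ}

/-- `Var_T f = ∑ᵢ Var_T fⁱ`, the sum of the total variations on `[0, T]` of the components of `f`,
with the convention `f(0-) = 0`. -/
noncomputable def totalVar (f : Time T → EuclideanSpace ℝ (Fin d)) : ℝ≥0∞ :=
  ∑ i, (‖f (startTime T) i‖ₑ + eVariationOn (fun t => f t i) univ)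

/-- The total variation on `[0, T]` of the vector-valued path `f` measured in the Euclidean norm,
with the convention `f(0-) = 0`. -/
noncomputable def euclideanVar (f : Time T → EuclideanSpace ℝ (Fin d)) : ℝ≥0∞ :=
  ‖f (startTime T)‖ₑ + eVariationOn f univ

open Classical in
/-- The pathwise Lebesgue--Stieltjes integral `∫_{[0, t]} g db` of a scalar function `g` against a
right-continuous function `b` of bounded variation, with the convention `b(0-) = 0`: the atom of
`db` at `0` is `b(0)`, and on `(0, T]` the signed measure `db` has mass `b(v) - b(u)` on `(u, v]`.
(The value is `0` if `b` has infinite variation.) -/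
noncomputable def stieltjesIntegral (g b : Time T → ℝ) (t : Time T) : ℝ :=
  if hb : BoundedVariationOn b univ then
    g (startTime T) * b (startTime T) + ∫ᵛ s in Iic t, g s ∂•hb.vectorMeasure
  else 0

end Variation

section Cone

variable {d : ℕ}

/-- The dual cone `K* = {y : ⟪x, y⟫ ≥ 0 for all x ∈ K}`. -/
noncomputable def dualCone (K : ProperCone ℝ (EuclideanSpace ℝ (Fin d))) :
    ProperCone ℝ (EuclideanSpace ℝ (Fin d)) :=
  ProperCone.innerDual (K : Set (EuclideanSpace ℝ (Fin d)))

/-- The `ε`-interior of a closed convex cone `G`. -/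
def epsInterior (ε : ℝ) (G : ProperCone ℝ (EuclideanSpace ℝ (Fin d))) :
    Set (EuclideanSpace ℝ (Fin d)) :=
  {x | ∀ y ∈ dualCone G, y ≠ 0 → ε * ‖x‖ * ‖y‖ < ⟪x, y⟫_ℝ}

/-- `K` is a solvency cone: a closed convex cone (this is the type of `K`) which is proper, i.e.
`K ∩ (-K) = {0}`, and contains the nonnegative orthant. -/
structure IsSolvencyCone (K : ProperCone ℝ (EuclideanSpace ℝ (Fin d))) : Prop where
  proper : ∀ y ∈ K, -y ∈ K → y = 0
  orthant_subset : ∀ y : EuclideanSpace ℝ (Fin d), (∀ i, 0 ≤ y i) → y ∈ K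

/-- The purchase function `℘(x) = inf {y ∈ ℝ : y e₁ - x ∈ K}`, with `inf ∅ = +∞`. -/
noncomputable def purchase [NeZero d] (K : ProperCone ℝ (EuclideanSpace ℝ (Fin d)))
    (x : EuclideanSpace ℝ (Fin d)) : EReal :=
  sInf ((fun y : ℝ => (y : EReal)) '' {y | y • EuclideanSpace.single 0 (1 : ℝ) - x ∈ K})

/-- The componentwise quotient `z / s`. -/
noncomputable def quotient (z s : EuclideanSpace ℝ (Fin d)) : EuclideanSpace ℝ (Fin d) :=
  WithLp.toLp 2 fun i => z i / s i

end Cone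

section Market

variable {Ω : Type*} [mΩ : MeasurableSpace Ω] {T : ℝ} [Fact (0 < T)] {d : ℕ} [NeZero d]

/-- `S` is a price process for the filtration `𝓕`: adapted, continuous, with strictly positive
entries, with the first asset (index `0`) as numeraire, and normalised by `S₀ = (1, …, 1)`. -/
structure IsPriceProcess (P : Measure Ω) (𝓕 : Filtration (Time T) mΩ)
    (S : Time T → Ω → EuclideanSpace ℝ (Fin d)) : Prop where
  adapted : Adapted 𝓕 S
  continuous : ∀ᵐ ω ∂P, Continuous fun t => S t ω
  pos : ∀ᵐ ω ∂P, ∀ t i, 0 < S t ω i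
  numeraire : ∀ᵐ ω ∂P, ∀ t, S t ω 0 = 1
  initial : ∀ᵐ ω ∂P, ∀ i, S (startTime T) ω i = 1

/-- A strategy: a `𝓖`-adapted càdlàg process `B` whose paths are `K`-decreasing on `{0-} ∪ [0, T]`,
where `B_{0-} = 0`; so the initial transaction also satisfies `B_{0-} - B_0 = -B_0 ∈ K`. -/
structure IsStrategy (P : Measure Ω) (𝓖 : Filtration (Time T) mΩ)
    (K : ProperCone ℝ (EuclideanSpace ℝ (Fin d)))
    (B : Time T → Ω → EuclideanSpace ℝ (Fin d)) : Prop where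
  adapted : Adapted 𝓖 B
  rcll : ∀ᵐ ω ∂P, IsRCLL fun t => B t ω
  initial : ∀ᵐ ω ∂P, -B (startTime T) ω ∈ K
  decreasing : ∀ᵐ ω ∂P, ∀ s t, s ≤ t → B s ω - B t ω ∈ K

/-- The portfolio in physical units, `V̂ = x + (1/S) · B`. -/
noncomputable def physicalPortfolio (S : Time T → Ω → EuclideanSpace ℝ (Fin d))
    (x : EuclideanSpace ℝ (Fin d)) (B : Time T → Ω → EuclideanSpace ℝ (Fin d))
    (t : Time T) (ω : Ω) : EuclideanSpace ℝ (Fin d) :=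
  WithLp.toLp 2 fun i =>
    x i + stieltjesIntegral (fun s => 1 / S s ω i) (fun s => B s ω i) t

/-- The portfolio in terms of the numeraire, `V = S ⊙ V̂`. -/
noncomputable def portfolio (S : Time T → Ω → EuclideanSpace ℝ (Fin d))
    (x : EuclideanSpace ℝ (Fin d)) (B : Time T → Ω → EuclideanSpace ℝ (Fin d))
    (t : Time T) (ω : Ω) : EuclideanSpace ℝ (Fin d) :=
  WithLp.toLp 2 fun i => S t ω i * physicalPortfolio S x B t ω i

/-- The set `𝒜(x)` of admissible strategies: those with `V_t ∈ K` a.s. for all `t`. -/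
def admissible (P : Measure Ω) (𝓖 : Filtration (Time T) mΩ)
    (K : ProperCone ℝ (EuclideanSpace ℝ (Fin d))) (S : Time T → Ω → EuclideanSpace ℝ (Fin d))
    (x : EuclideanSpace ℝ (Fin d)) : Set (Time T → Ω → EuclideanSpace ℝ (Fin d)) :=
  {B | IsStrategy P 𝓖 K B ∧ ∀ t, ∀ᵐ ω ∂P, portfolio S x B t ω ∈ K}

/-- A consistent price system: an `ℝᵈ₊`-valued right-continuous `𝓕`-martingale `Z` such that
`Z_t / S_t ∈ K* \ {0}` a.s. for every `t`. -/
structure IsCPS (P : Measure Ω) (𝓕 : Filtration (Time T) mΩ)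
    (K : ProperCone ℝ (EuclideanSpace ℝ (Fin d))) (S : Time T → Ω → EuclideanSpace ℝ (Fin d))
    (Z : Time T → Ω → EuclideanSpace ℝ (Fin d)) : Prop where
  martingale : Martingale Z 𝓕 P
  rightContinuous : ∀ᵐ ω ∂P, ∀ t, ContinuousWithinAt (fun s => Z s ω) (Ici t) t
  nonneg : ∀ t, ∀ᵐ ω ∂P, ∀ i, 0 ≤ Z t ω i
  mem_dual : ∀ t, ∀ᵐ ω ∂P, quotient (Z t ω) (S t ω) ∈ dualCone K ∧ quotient (Z t ω) (S t ω) ≠ 0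

/-- The set `ℳ_ε(K)` of `ε`-consistent price systems. -/
def epsCPS (P : Measure Ω) (𝓕 : Filtration (Time T) mΩ)
    (K : ProperCone ℝ (EuclideanSpace ℝ (Fin d))) (S : Time T → Ω → EuclideanSpace ℝ (Fin d))
    (ε : ℝ) : Set (Time T → Ω → EuclideanSpace ℝ (Fin d)) :=
  {Z | IsCPS P 𝓕 K S Z ∧
    ∀ t, ∀ᵐ ω ∂P, quotient (Z t ω) (S t ω) ∈ epsInterior ε (dualCone K) \ {0}}

/-- The measure `Q = Z¹_T P`. -/
noncomputable def densityMeasure (P : Measure Ω) (Z : Time T → Ω → EuclideanSpace ℝ (Fin d)) :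
    Measure Ω :=
  P.withDensity fun ω => ENNReal.ofReal (Z (endTime T) ω 0)

/-- Tightness of a family of random variables with values in `[0, ∞]`, regarded as a.s. finite
random variables: the laws are uniformly concentrated, up to any `δ > 0`, on a compact interval
`[0, c]` with `c < ∞`. -/
def IsTightFamily (P : Measure Ω) (X : Set (Ω → ℝ≥0∞)) : Prop :=
  ∀ δ : ℝ≥0∞, 0 < δ → ∃ c : ℝ≥0, ∀ R ∈ X, P {ω | (c : ℝ≥0∞) < R ω} ≤ δ

end Market

end KabanovModel

/-! Under a consistent price system the value Z·V̂ drops at every trade while Z itself is a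
martingale. A trade dB ∈ -K contributes (Z/S)·dB ≤ -ε|Z/S||dB| ≤ -ε Z¹|dB|, the last step because S¹
= 1. Admissibility keeps Z·V̂ nonnegative, so ε E[Z¹_T Varᵉ_T B] ≤ E[Z_0·x]. Since S_0 = (1,…,1),
Z_0 lies in K*, hence Z_0·x ≤ y Z¹_0 whenever y e₁ - x ∈ K; this gives the bound under Q. Tightness
follows from the same estimate by Markov's inequality, because Z¹_T > 0 a.s. Strategies are only
𝔾-adapted, but ξ is independent of 𝓕_t, so Z stays a martingale for 𝔾 (`martingale_filtrationG`).

Integration by parts in continuous time is avoided by sampling on regular grids. Trades are executed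
at the price at the end of each step, and the position is dropped at the first date at which its
variation exceeds a level c, so that every pairing with Z is integrable. The sampled portfolio need
not be solvent; `shortfall` bounds the defect, which is charged at most once, at the crossing of c
or at the terminal date (`IsDiscreteMarket.stoppedVar_estimate`). On almost every path, uniform
continuity of S and 1/S together with bounded variation of B makes the shortfall vanish uniformly
along the grid (`exists_forall_shortfall_le`). Dominated convergence removes it from the estimate,
and Fatou's lemma, in the mesh and then in c, recovers the full variation
(`IsMarket.exists_measurable_majorant`). -/

namespace KabanovModel

/-! ### Pathwise Stieltjes integrals of continuous functions -/

section Stieltjes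

variable {T : ℝ}

instance finite_variation_vectorMeasure {α : Type*} [MeasurableSpace α] (μ : SignedMeasure α) :
    IsFiniteMeasure μ.variation := by
  rw [← SignedMeasure.totalVariation_eq_variation]
  infer_instance

theorem integrable_vectorMeasure_of_continuous {g : Time T → ℝ} (hg : Continuous g)
    (μ : SignedMeasure (Time T)) : μ.Integrable g :=
  hg.integrable_of_hasCompactSupport (HasCompactSupport.of_compactSpace g)

variable [Fact (0 < T)]

theorem startTime_le (t : Time T) : startTime T ≤ t := t.2.1

theorem le_endTime (t : Time T) : t ≤ endTime T := t.2.2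

theorem stieltjesIntegral_startTime {g b : Time T → ℝ} (hb : BoundedVariationOn b univ)
    (hbr : ∀ t, ContinuousWithinAt b (Ici t) t) :
    stieltjesIntegral g b (startTime T) = g (startTime T) * b (startTime T) := by
  have hbot : IsBot (startTime T) := startTime_le
  have h : Iic (startTime T) = {startTime T} := by
    ext t
    exact ⟨fun h => le_antisymm h (startTime_le t), fun h => h.le⟩
  rw [stieltjesIntegral, dif_pos hb, h, VectorMeasure.integral_singleton,
    hb.vectorMeasure_singleton, (hbr _).rightLim_eq, leftLim_eq_of_isBot hbot]
  simp

/-- The error of a one-point Riemann sum with the right endpoint as tag is ∫ (g - g v) db over (u,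
v]. The right endpoint matches trades executed at the end of a grid step. -/
theorem abs_stieltjesIntegral_sub_sub_le {g b : Time T → ℝ} (hg : Continuous g)
    (hb : BoundedVariationOn b univ) (hbr : ∀ t, ContinuousWithinAt b (Ici t) t)
    {u v : Time T} (huv : u ≤ v) {C : ℝ} (hC : ∀ s ∈ Icc u v, |g s - g v| ≤ C) :
    |stieltjesIntegral g b v - stieltjesIntegral g b u - g v * (b v - b u)| ≤
      C * hb.vectorMeasure.variation.real (Ioc u v) := by
  have hint := integrable_vectorMeasure_of_continuous hg hb.vectorMeasure
  have hc := integrable_vectorMeasure_of_continuous (continuous_const (y := g v)) hb.vectorMeasure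
  have h1 : ∫ᵛ s in Iic v, g s ∂•hb.vectorMeasure =
      ∫ᵛ s in Iic u, g s ∂•hb.vectorMeasure + ∫ᵛ s in Ioc u v, g s ∂•hb.vectorMeasure := by
    rw [← Iic_union_Ioc_eq_Iic huv]
    exact VectorMeasure.setIntegral_union (by grind) measurableSet_Iic
      measurableSet_Ioc hint.integrableOn hint.integrableOn
  have h2 : ∫ᵛ _ in Ioc u v, g v ∂•hb.vectorMeasure = g v * (b v - b u) := by
    rw [VectorMeasure.setIntegral_const, hb.vectorMeasure_Ioc huv, (hbr _).rightLim_eq,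
      (hbr _).rightLim_eq]
    simp
  have h3 : stieltjesIntegral g b v - stieltjesIntegral g b u - g v * (b v - b u) =
      ∫ᵛ s in Ioc u v, (g s - g v) ∂•hb.vectorMeasure := by
    rw [VectorMeasure.integral_fun_sub hint.integrableOn hc.integrableOn, h2, stieltjesIntegral,
      stieltjesIntegral, dif_pos hb, dif_pos hb, h1]
    ring
  rw [h3, ← Real.norm_eq_abs]
  refine (VectorMeasure.norm_setIntegral_le_of_norm_le_const (μ := hb.vectorMeasure)
    (s := Ioc u v) (fun s hs => hC s (Ioc_subset_Icc_self hs))).trans ?_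
  have : 0 ≤ C := (abs_nonneg _).trans (hC v ⟨huv, le_rfl⟩)
  have h4 : ‖ContinuousLinearMap.lsmul ℝ ℝ (E := ℝ)‖ ≤ 1 := ContinuousLinearMap.opNorm_lsmul_le
  calc _ ≤ C * 1 * hb.vectorMeasure.variation.real (Ioc u v) := by gcongr
    _ = _ := by ring

theorem exists_abs_stieltjesIntegral_le {g b : Time T → ℝ} (hg : Continuous g)
    (hb : BoundedVariationOn b univ) : ∃ M, ∀ t, |stieltjesIntegral g b t| ≤ M := by
  obtain ⟨C, hC⟩ := isCompact_univ.exists_bound_of_continuousOn (f := g) hg.continuousOn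
  have hC0 : 0 ≤ C := (norm_nonneg _).trans (hC (startTime T) (mem_univ _))
  refine ⟨|g (startTime T) * b (startTime T)| +
    C * ‖ContinuousLinearMap.lsmul ℝ ℝ (E := ℝ)‖ * hb.vectorMeasure.variation.real univ,
    fun t => ?_⟩
  rw [stieltjesIntegral, dif_pos hb]
  refine (abs_add_le _ _).trans (add_le_add le_rfl ?_)
  refine (VectorMeasure.norm_setIntegral_le_of_norm_le_const (μ := hb.vectorMeasure)
    (B := ContinuousLinearMap.lsmul ℝ ℝ) (f := g) (s := Iic t) (fun s _ => hC s (mem_univ _))).trans ?_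
  gcongr
  · simp
  · exact subset_univ _

end Stieltjes

/-! ### Regular grids and variation along them -/

section Grid

variable {T : ℝ}

theorem dist_right_le_of_mem_Icc {u v s : Time T} (hs : s ∈ Icc u v) : dist s v ≤ dist u v := by
  rw [Subtype.dist_eq, Subtype.dist_eq, Real.dist_eq, Real.dist_eq, abs_sub_comm,
    abs_sub_comm (u : ℝ), abs_of_nonneg (sub_nonneg.2 (Subtype.coe_le_coe.2 hs.2)),
    abs_of_nonneg (sub_nonneg.2 (Subtype.coe_le_coe.2 (hs.1.trans hs.2)))]
  exact sub_le_sub_left (Subtype.coe_le_coe.2 hs.1) _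

variable [hT : Fact (0 < T)]

/-- The points of the regular grid with `n + 1` steps on `[0, T]`, constant after time `T`. -/
noncomputable def grid (T : ℝ) [hT : Fact (0 < T)] (n j : ℕ) : Time T :=
  projIcc 0 T hT.out.le (T * (j / (n + 1 : ℝ)))

theorem grid_mono (n : ℕ) : Monotone (grid T n) := by
  intro i j hij
  have := hT.out
  apply monotone_projIcc
  gcongr

theorem grid_zero (n : ℕ) : grid T n 0 = startTime T := by
  simp [grid, startTime]

theorem grid_eq_endTime {n j : ℕ} (h : n + 1 ≤ j) : grid T n j = endTime T := by
  apply projIcc_of_right_le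
  have : (1 : ℝ) ≤ j / (n + 1 : ℝ) := by
    rw [le_div_iff₀ (by positivity)]
    exact_mod_cast (by simpa using h)
  nlinarith [hT.out]

theorem dist_grid_le (n j : ℕ) : dist (grid T n j) (grid T n (j + 1)) ≤ T / (n + 1) := by
  have := hT.out
  rw [Subtype.dist_eq, dist_comm, Real.dist_eq]
  refine (abs_projIcc_sub_projIcc hT.out.le).trans (le_of_eq ?_)
  rw [abs_of_nonneg]
  · push_cast
    field_simp
    ring
  · push_cast
    rw [sub_nonneg]
    gcongr
    simp

theorem le_grid_ceil (n : ℕ) (t : Time T) : t ≤ grid T n ⌈(t : ℝ) * (n + 1) / T⌉₊ := by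
  have := hT.out
  have h : (t : ℝ) ≤ T * ((⌈(t : ℝ) * (n + 1) / T⌉₊ : ℝ) / (n + 1)) := by
    have := Nat.le_ceil ((t : ℝ) * (n + 1) / T)
    rw [div_le_iff₀ hT.out] at this
    rw [← mul_div_assoc, le_div_iff₀ (by positivity)]
    linarith
  calc t = projIcc 0 T hT.out.le (t : ℝ) := (projIcc_val _ t).symm
    _ ≤ _ := monotone_projIcc _ h

/-- Rounding up makes the grid points approach t from the right, the only side on which a càdlàg
path is continuous. -/
theorem tendsto_grid_ceil (t : Time T) :
    Tendsto (fun n : ℕ => grid T n ⌈(t : ℝ) * (n + 1) / T⌉₊) atTop (𝓝[≥] t) := by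
  have hT' := hT.out
  refine tendsto_nhdsWithin_iff.2 ⟨?_, Eventually.of_forall fun n => le_grid_ceil n t⟩
  have h : Tendsto (fun n : ℕ => T * ((⌈(t : ℝ) * (n + 1) / T⌉₊ : ℝ) / (n + 1))) atTop
      (𝓝 (t : ℝ)) := by
    have h1 : Tendsto (fun n : ℕ => (t : ℝ) + T * (1 / ((n : ℝ) + 1))) atTop (𝓝 t) := by
      simpa using tendsto_const_nhds.add
        (tendsto_one_div_add_atTop_nhds_zero_nat.const_mul T)
    refine tendsto_of_tendsto_of_tendsto_of_le_of_le tendsto_const_nhds h1 (fun n => ?_)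
      (fun n => ?_)
    · have := Nat.le_ceil ((t : ℝ) * (n + 1) / T)
      rw [div_le_iff₀ hT.out] at this
      simp only
      rw [← mul_div_assoc, le_div_iff₀ (by positivity)]
      linarith
    · have h0 : 0 ≤ (t : ℝ) * (n + 1) / T := by
        have := t.2.1
        positivity
      have := (Nat.ceil_lt_add_one h0).le
      simp only
      rw [← mul_div_assoc, div_le_iff₀ (by positivity)]
      have h2 : T * ((t : ℝ) * (n + 1) / T) = t * (n + 1) := by field_simp
      have h3 : ((t : ℝ) + T * (1 / ((n : ℝ) + 1))) * (n + 1) = t * (n + 1) + T := by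
        field_simp
      rw [h3]
      nlinarith
  have := (continuous_projIcc (h := hT.out.le)).continuousAt.tendsto.comp h
  simpa [grid, Function.comp_def] using this

/-- The total variation of a right-continuous path is at most the lower limit of its variations
along the regular grids. -/
theorem eVariationOn_le_liminf_grid {E : Type*} [PseudoEMetricSpace E] {f : Time T → E}
    (hf : ∀ t, ContinuousWithinAt f (Ici t) t) :
    eVariationOn f univ ≤ liminf (fun n : ℕ =>
      ∑ j ∈ Finset.range (n + 1), edist (f (grid T n j)) (f (grid T n (j + 1)))) atTop := by
  have hT' := hT.out
  refine iSup_le fun ⟨k, u, hu, _⟩ => ?_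
  set c : ℕ → ℕ → ℕ := fun n i => ⌈(u i : ℝ) * (n + 1) / T⌉₊ with hc
  have hcm (n : ℕ) : Monotone (c n) := fun i j hij => by
    have : (u i : ℝ) ≤ u j := hu hij
    simp only [hc]
    gcongr
  have hck (n i : ℕ) : c n i ≤ n + 1 := by
    refine Nat.ceil_le.2 ?_
    rw [div_le_iff₀ hT.out]
    push_cast
    rw [mul_comm]
    gcongr
    exact (u i).2.2
  have h1 : Tendsto (fun n => ∑ i ∈ Finset.range k,
      edist (f (grid T n (c n (i + 1)))) (f (grid T n (c n i)))) atTop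
      (𝓝 (∑ i ∈ Finset.range k, edist (f (u (i + 1))) (f (u i)))) := by
    refine tendsto_finsetSum _ fun i _ => ?_
    exact Filter.Tendsto.edist ((hf _).tendsto.comp (tendsto_grid_ceil (u (i + 1))))
      ((hf _).tendsto.comp (tendsto_grid_ceil (u i)))
  refine h1.liminf_eq.symm.le.trans (liminf_le_liminf (Eventually.of_forall fun n => ?_))
  -- The rounded partition is coarser than the grid, so the triangle inequality bounds its sum by
  -- the grid sum.
  have h2 : ∀ k, ∑ i ∈ Finset.range k,
      edist (f (grid T n (c n (i + 1)))) (f (grid T n (c n i))) ≤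
      ∑ j ∈ Finset.Ico (c n 0) (c n k), edist (f (grid T n j)) (f (grid T n (j + 1))) := by
    intro k
    induction k with
    | zero => simp
    | succ k ih =>
      rw [Finset.sum_range_succ, ← Finset.sum_Ico_consecutive _ (hcm n (Nat.zero_le k))
        (hcm n (Nat.le_succ k)), edist_comm]
      exact add_le_add ih
        (edist_le_Ico_sum_edist (fun j => f (grid T n j)) (hcm n (Nat.le_succ k)))
  refine (h2 k).trans (Finset.sum_le_sum_of_subset fun j hj => ?_)
  simp only [Finset.mem_Ico, Finset.mem_range] at hj ⊢
  exact hj.2.trans_le (hck n k)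

end Grid

/-! ### Enlargement of the filtration by ξ -/

section Independence

variable {Ω : Type*} [mΩ : MeasurableSpace Ω] {P : Measure Ω} {m : ℕ} {T : ℝ}
  {Y : Time T → Ω → EuclideanSpace ℝ (Fin m)}

/-- Adjoining null events changes sets of σ(Y) only up to null sets, and independence does not see
such changes. -/
theorem filtrationF_le_eventuallyMeasurableSpace (hY : ∀ t, Measurable (Y t)) (t : Time T) :
    filtrationF P Y hY t ≤ eventuallyMeasurableSpace
      (MeasurableSpace.comap (fun ω t => Y t ω) inferInstance) (ae P) := by
  refine sup_le ?_ (MeasurableSpace.generateFrom_le fun A hA => ?_)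
  · refine le_trans (iSup₂_le fun s _ => ?_) le_eventuallyMeasurableSpace
    have : Y s = (fun y : Time T → EuclideanSpace ℝ (Fin m) => y s) ∘ fun ω t => Y t ω := rfl
    rw [this, ← MeasurableSpace.comap_comp]
    exact MeasurableSpace.comap_mono (measurable_pi_apply s).comap_le
  · exact ⟨∅, @MeasurableSet.empty _ (_), ae_eq_empty.2 hA.2⟩

theorem indep_filtrationF {ξ : Ω → ℝ} (h : IsBasis P Y ξ) (t : Time T) :
    Indep (filtrationF P Y h.measurable_Y t) (MeasurableSpace.comap ξ inferInstance) P := by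
  rw [Indep_iff]
  intro A E hA hE
  obtain ⟨A', hA', hAA'⟩ := filtrationF_le_eventuallyMeasurableSpace h.measurable_Y t A hA
  have := (Indep_iff _ _ _).1 h.indep_ξ_Y.symm A' E hA' hE
  rw [measure_congr hAA', ← this]
  exact measure_congr (hAA'.inter (ae_eq_refl E))

theorem sup_eq_generateFrom_image2_inter {α : Type*} (m₁ m₂ : MeasurableSpace α) :
    m₁ ⊔ m₂ = MeasurableSpace.generateFrom
      (image2 (· ∩ ·) {A | MeasurableSet[m₁] A} {B | MeasurableSet[m₂] B}) := by
  refine le_antisymm (sup_le (fun A hA => ?_) fun B hB => ?_)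
    (MeasurableSpace.generateFrom_le ?_)
  · exact MeasurableSpace.measurableSet_generateFrom
      ⟨A, hA, univ, @MeasurableSet.univ _ m₂, inter_univ A⟩
  · exact MeasurableSpace.measurableSet_generateFrom
      ⟨univ, @MeasurableSet.univ _ m₁, B, hB, univ_inter B⟩
  · rintro _ ⟨A, hA, B, hB, rfl⟩
    exact MeasurableSet.inter (le_sup_left (a := m₁) A hA) (le_sup_right (b := m₂) B hB)

theorem isPiSystem_image2_inter {α : Type*} (m₁ m₂ : MeasurableSpace α) :
    IsPiSystem (image2 (· ∩ ·) {A | MeasurableSet[m₁] A} {B | MeasurableSet[m₂] B}) := by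
  rintro _ ⟨A, hA, B, hB, rfl⟩ _ ⟨A', hA', B', hB', rfl⟩ _
  exact ⟨A ∩ A', MeasurableSet.inter hA hA', B ∩ B', MeasurableSet.inter hB hB',
    inter_inter_inter_comm _ _ _ _⟩

/-- Enlarging a filtration by an independent σ-algebra preserves martingales. -/
theorem martingale_filtrationG [IsProbabilityMeasure P] {ξ : Ω → ℝ} (h : IsBasis P Y ξ)
    {E : Type*} [NormedAddCommGroup E] [NormedSpace ℝ E] [CompleteSpace E] {Z : Time T → Ω → E}
    (hZ : Martingale Z (filtrationF P Y h.measurable_Y) P) :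
    Martingale Z (filtrationG P Y h.measurable_Y ξ h.measurable_ξ) P := by
  have hle : filtrationF P Y h.measurable_Y ≤
      filtrationG P Y h.measurable_Y ξ h.measurable_ξ := le_sup_left
  have had : StronglyAdapted (filtrationG P Y h.measurable_Y ξ h.measurable_ξ) Z :=
    fun t => (hZ.1 t).mono (hle t)
  refine ⟨had, fun s t hst => (ae_eq_condExp_of_forall_setIntegral_eq
    (Filtration.le _ s) (hZ.integrable t) (fun _ _ _ => (hZ.integrable s).integrableOn)
    (fun A hA hfin => ?_) (had s).aestronglyMeasurable).symm⟩
  have hD : Integrable (Z t - Z s) P := (hZ.integrable t).sub (hZ.integrable s)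
  have hFle := (filtrationF P Y h.measurable_Y).le t
  have hFst := (filtrationF P Y h.measurable_Y).mono hst
  have hξ := h.measurable_ξ.comap_le
  suffices ∫ ω in A, (Z t - Z s) ω ∂P = 0 by
    simp only [Pi.sub_apply] at this
    rw [integral_sub (hZ.integrable t).integrableOn (hZ.integrable s).integrableOn] at this
    exact (sub_eq_zero.1 this).symm
  have hbasic : ∀ F, MeasurableSet[filtrationF P Y h.measurable_Y s] F →
      ∀ B, MeasurableSet[MeasurableSpace.comap ξ inferInstance] B →
      ∫ ω in F ∩ B, (Z t - Z s) ω ∂P = 0 := by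
    intro F hF B hB
    have hF' : MeasurableSet F := hFle F (hFst F hF)
    have h0 : ∫ ω in F, (Z t - Z s) ω ∂P = 0 := by
      simp only [Pi.sub_apply]
      rw [integral_sub (hZ.integrable t).integrableOn (hZ.integrable s).integrableOn,
        sub_eq_zero]
      exact (hZ.setIntegral_eq hst hF).symm
    have hm : StronglyMeasurable[filtrationF P Y h.measurable_Y t]
        (F.indicator (Z t - Z s)) :=
      ((hZ.1 t).sub ((hZ.1 s).mono hFst)).indicator (hFst F hF)
    -- The variable 1_F (Z_t - Z_s) is 𝓕_t-measurable, hence independent of ξ: its conditional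
    -- expectation given ξ is its mean, which vanishes by the 𝔽-martingale property.
    have hc := condExp_indep_eq hFle hξ hm (indep_filtrationF h t)
    rw [integral_indicator hF', h0] at hc
    have h1 := setIntegral_condExp hξ (hD.indicator hF') hB
    rw [setIntegral_congr_ae (g := fun _ => (0 : E)) (hξ B hB)
      (hc.mono fun ω hω _ => hω), setIntegral_indicator hF', inter_comm] at h1
    simpa using h1.symm
  have hG : ((filtrationG P Y h.measurable_Y ξ h.measurable_ξ) s : MeasurableSpace Ω) =
      filtrationF P Y h.measurable_Y s ⊔ MeasurableSpace.comap ξ inferInstance := rfl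
  rw [hG] at hA
  clear hfin
  have hsup : (filtrationF P Y h.measurable_Y s : MeasurableSpace Ω) ⊔
      MeasurableSpace.comap ξ inferInstance ≤ mΩ := sup_le (Filtration.le _ s) hξ
  induction A, hA using MeasurableSpace.induction_on_inter
    (sup_eq_generateFrom_image2_inter _ _) (isPiSystem_image2_inter _ _) with
  | empty => simp
  | basic A hA =>
    obtain ⟨F, hF, B, hB, rfl⟩ := hA
    exact hbasic F hF B hB
  | compl A hA ih =>
    -- Passing to complements uses that the integral of Z_t - Z_s over the whole space is zero.
    have h1 := hbasic univ MeasurableSet.univ univ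
      (@MeasurableSet.univ _ (MeasurableSpace.comap ξ inferInstance))
    rw [inter_univ, setIntegral_univ] at h1
    have h2 := integral_add_compl (hsup A hA) hD
    rwa [ih, h1, zero_add] at h2
  | iUnion f hd hf ih =>
    rw [integral_iUnion (fun i => hsup _ (hf i)) hd hD.integrableOn]
    simp only [ih, tsum_zero]

end Independence

/-! ### Pairing a martingale with bounded vectors -/

section Pairing

variable {Ω : Type*} [mΩ : MeasurableSpace Ω] {P : Measure Ω}
  {E : Type*} [NormedAddCommGroup E] [InnerProductSpace ℝ E]

theorem integrable_inner_of_bounded {Z f : Ω → E} (hZ : Integrable Z P)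
    (hf : AEStronglyMeasurable f P) {C : ℝ} (hC : ∀ ω, ‖f ω‖ ≤ C) :
    Integrable (fun ω => ⟪Z ω, f ω⟫_ℝ) P := by
  refine (hZ.norm.mul_const C).mono' (hZ.aestronglyMeasurable.inner hf) (ae_of_all _ fun ω => ?_)
  exact (norm_inner_le_norm _ _).trans (by gcongr; exact hC ω)

theorem _root_.MeasureTheory.Martingale.integral_inner_eq [CompleteSpace E] [IsFiniteMeasure P] {ι : Type*}
    [Preorder ι] {𝓗 : Filtration ι mΩ} {Z : ι → Ω → E} (hZ : Martingale Z 𝓗 P) {i j : ι}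
    (hij : i ≤ j) {f : Ω → E} (hf : StronglyMeasurable[𝓗 i] f) {C : ℝ} (hC : ∀ ω, ‖f ω‖ ≤ C) :
    ∫ ω, ⟪Z j ω, f ω⟫_ℝ ∂P = ∫ ω, ⟪Z i ω, f ω⟫_ℝ ∂P := by
  have hint : Integrable (fun ω => innerSL ℝ (f ω) (Z j ω)) P := by
    refine (integrable_inner_of_bounded (hZ.integrable j)
      (hf.mono (𝓗.le i)).aestronglyMeasurable hC).congr (ae_of_all _ fun ω => ?_)
    simp [real_inner_comm]
  have h1 := condExp_bilin_of_stronglyMeasurable_left (innerSL ℝ) hf hint (hZ.integrable j)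
  rw [← integral_congr_ae (f := fun ω => innerSL ℝ (f ω) (Z j ω))
    (ae_of_all _ fun ω => by simp [real_inner_comm]), ← integral_condExp (𝓗.le i)]
  refine integral_congr_ae ?_
  filter_upwards [h1, hZ.2 i j hij] with ω h1 h2
  rw [h1, h2, innerSL_apply_apply, real_inner_comm]

end Pairing

/-! ### Dual cone, quotients and the shortfall -/

section Vectors

variable {d : ℕ}

theorem norm_le_sum_abs (v : EuclideanSpace ℝ (Fin d)) : ‖v‖ ≤ ∑ i, |v i| := by
  conv_lhs => rw [← (EuclideanSpace.basisFun (Fin d) ℝ).sum_repr v]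
  refine (norm_sum_le _ _).trans (Finset.sum_le_sum fun i _ => ?_)
  rw [norm_smul, OrthonormalBasis.norm_eq_one, mul_one]
  simp

theorem abs_apply_le_norm (z : EuclideanSpace ℝ (Fin d)) (i : Fin d) : |z i| ≤ ‖z‖ := by
  simpa using PiLp.norm_apply_le z i

/-- The vector all of whose entries are `1`. -/
noncomputable def ones (d : ℕ) : EuclideanSpace ℝ (Fin d) := WithLp.toLp 2 fun _ => 1

/-- The componentwise product of vectors. -/
noncomputable def hadamard (s w : EuclideanSpace ℝ (Fin d)) : EuclideanSpace ℝ (Fin d) :=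
  WithLp.toLp 2 fun i => s i * w i

theorem inner_eq_sum (z w : EuclideanSpace ℝ (Fin d)) : ⟪z, w⟫_ℝ = ∑ i, z i * w i := by
  simp [PiLp.inner_apply, mul_comm]

theorem inner_ones (z : EuclideanSpace ℝ (Fin d)) : ⟪z, ones d⟫_ℝ = ∑ i, z i := by
  simp [inner_eq_sum, ones]

theorem inner_ones_nonneg {z : EuclideanSpace ℝ (Fin d)} (hz : ∀ i, 0 ≤ z i) :
    0 ≤ ⟪z, ones d⟫_ℝ := by
  rw [inner_ones]
  exact Finset.sum_nonneg fun i _ => hz i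

theorem norm_le_inner_ones {z : EuclideanSpace ℝ (Fin d)} (hz : ∀ i, 0 ≤ z i) :
    ‖z‖ ≤ ⟪z, ones d⟫_ℝ := by
  rw [inner_ones]
  exact (norm_le_sum_abs z).trans_eq (Finset.sum_congr rfl fun i _ => abs_of_nonneg (hz i))

theorem inner_quotient_right (z b s : EuclideanSpace ℝ (Fin d)) :
    ⟪z, quotient b s⟫_ℝ = ⟪quotient z s, b⟫_ℝ := by
  simp only [inner_eq_sum, quotient]
  exact Finset.sum_congr rfl fun i _ => by ring

theorem inner_quotient_hadamard {s : EuclideanSpace ℝ (Fin d)} (hs : ∀ i, 0 < s i)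
    (z w : EuclideanSpace ℝ (Fin d)) : ⟪quotient z s, hadamard s w⟫_ℝ = ⟪z, w⟫_ℝ := by
  simp only [inner_eq_sum, quotient, hadamard]
  refine Finset.sum_congr rfl fun i _ => ?_
  have := (hs i).ne'
  field_simp

/-- A bound for the distance of the physical position `w` from solvency at prices `s`. -/
noncomputable def shortfall (K : ProperCone ℝ (EuclideanSpace ℝ (Fin d)))
    (s w : EuclideanSpace ℝ (Fin d)) : ℝ :=
  (∑ i, 1 / s i) * Metric.infDist (hadamard s w) K

theorem shortfall_nonneg (K : ProperCone ℝ (EuclideanSpace ℝ (Fin d)))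
    {s : EuclideanSpace ℝ (Fin d)} (hs : ∀ i, 0 < s i) (w : EuclideanSpace ℝ (Fin d)) :
    0 ≤ shortfall K s w :=
  mul_nonneg (Finset.sum_nonneg fun i _ => (one_div_pos.2 (hs i)).le) Metric.infDist_nonneg

theorem mem_dualCone {K : ProperCone ℝ (EuclideanSpace ℝ (Fin d))}
    {y : EuclideanSpace ℝ (Fin d)} : y ∈ dualCone K ↔ ∀ k ∈ K, 0 ≤ ⟪k, y⟫_ℝ := by
  simp [dualCone]

/-- Write s ⊙ w as its nearest point in K plus a remainder. The dual vector z/s is nonnegative on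
the first, and Cauchy–Schwarz controls the second, with |z/s| ≤ (∑ zᵢ)(∑ 1/sᵢ). -/
theorem neg_inner_le_shortfall {K : ProperCone ℝ (EuclideanSpace ℝ (Fin d))}
    {s z : EuclideanSpace ℝ (Fin d)} (hs : ∀ i, 0 < s i) (hz : ∀ i, 0 ≤ z i)
    (hK : quotient z s ∈ dualCone K) (w : EuclideanSpace ℝ (Fin d)) :
    -⟪z, w⟫_ℝ ≤ ⟪z, ones d⟫_ℝ * shortfall K s w := by
  obtain ⟨k, hk, hdist⟩ := K.isClosed.exists_infDist_eq_dist ⟨0, K.zero_mem⟩ (hadamard s w)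
  have h1 : ⟪z, w⟫_ℝ = ⟪quotient z s, k⟫_ℝ + ⟪quotient z s, hadamard s w - k⟫_ℝ := by
    rw [← inner_add_right, add_sub_cancel, inner_quotient_hadamard hs]
  have h2 : 0 ≤ ⟪quotient z s, k⟫_ℝ := by
    rw [real_inner_comm]
    exact mem_dualCone.1 hK k hk
  have h3 : -⟪quotient z s, hadamard s w - k⟫_ℝ ≤ ‖quotient z s‖ * ‖hadamard s w - k‖ :=
    (neg_le_abs _).trans (abs_real_inner_le_norm _ _)
  have h4 : ‖quotient z s‖ ≤ ⟪z, ones d⟫_ℝ * ∑ i, 1 / s i := by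
    refine (norm_le_sum_abs _).trans ?_
    rw [Finset.mul_sum]
    refine Finset.sum_le_sum fun i _ => ?_
    have h5 : z i ≤ ⟪z, ones d⟫_ℝ := by
      rw [inner_ones]
      exact Finset.single_le_sum (fun i _ => hz i) (Finset.mem_univ i)
    have h6 := hs i
    rw [show (quotient z s) i = z i / s i from rfl, abs_of_nonneg (div_nonneg (hz i) h6.le),
      div_eq_mul_one_div]
    gcongr
  rw [shortfall, hdist, dist_eq_norm, ← mul_assoc]
  have := mul_le_mul_of_nonneg_right h4 (norm_nonneg (hadamard s w - k))
  linarith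

/-- The truncation by C keeps the shortfall term integrable against z and supplies the dominating
function for the limit. -/
theorem neg_inner_le_min {K : ProperCone ℝ (EuclideanSpace ℝ (Fin d))}
    {s z w : EuclideanSpace ℝ (Fin d)} (hs : ∀ i, 0 < s i) (hz : ∀ i, 0 ≤ z i)
    (hK : quotient z s ∈ dualCone K) {C : ℝ} (hw : ‖w‖ ≤ C) :
    -⟪z, w⟫_ℝ ≤ ⟪z, ones d⟫_ℝ * min C (shortfall K s w) := by
  rcases min_choice C (shortfall K s w) with h | h <;> rw [h]
  · calc -⟪z, w⟫_ℝ ≤ ‖z‖ * ‖w‖ := (neg_le_abs _).trans (abs_real_inner_le_norm _ _)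
      _ ≤ _ := mul_le_mul (norm_le_inner_ones hz) hw (norm_nonneg _) (inner_ones_nonneg hz)
  · exact neg_inner_le_shortfall hs hz hK w

section Measurability

variable {α : Type*} {_ : MeasurableSpace α} {f g : α → EuclideanSpace ℝ (Fin d)}

theorem measurable_coord (hf : Measurable f) (i : Fin d) : Measurable fun a => f a i :=
  (EuclideanSpace.proj (𝕜 := ℝ) i).continuous.measurable.comp hf

theorem measurable_of_coord (hf : ∀ i, Measurable fun a => f a i) : Measurable f :=
  (WithLp.measurable_toLp 2 (Fin d → ℝ)).comp (measurable_pi_lambda _ hf)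

theorem measurable_quotient (hf : Measurable f) (hg : Measurable g) :
    Measurable fun a => quotient (f a) (g a) :=
  measurable_of_coord fun i => (measurable_coord hf i).div (measurable_coord hg i)

theorem measurable_hadamard (hf : Measurable f) (hg : Measurable g) :
    Measurable fun a => hadamard (f a) (g a) :=
  measurable_of_coord fun i => (measurable_coord hf i).mul (measurable_coord hg i)

theorem measurable_shortfall (K : ProperCone ℝ (EuclideanSpace ℝ (Fin d))) (hf : Measurable f)
    (hg : Measurable g) : Measurable fun a => shortfall K (f a) (g a) :=
  (Finset.measurable_sum _ fun i _ => measurable_const.div (measurable_coord hf i)).mul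
    ((Metric.continuous_infDist_pt _).measurable.comp (measurable_hadamard hf hg))

end Measurability

end Vectors

/-! ### Discrete portfolios and stopped variation -/

section Discrete

variable {d : ℕ}

/-- The portfolio in physical units of the trades `β` executed at the prices `s`. -/
noncomputable def discretePortfolio (x : EuclideanSpace ℝ (Fin d))
    (s β : ℕ → EuclideanSpace ℝ (Fin d)) (j : ℕ) : EuclideanSpace ℝ (Fin d) :=
  x + ∑ i ∈ Finset.range j, quotient (β (i + 1) - β i) (s (i + 1))

/-- The variation of the trades `β`, both in money and in physical units. -/
noncomputable def discreteVar (s β : ℕ → EuclideanSpace ℝ (Fin d)) (j : ℕ) : ℝ :=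
  ∑ i ∈ Finset.range j, (‖quotient (β (i + 1) - β i) (s (i + 1))‖ + ‖β (i + 1) - β i‖)

/-- The variation of `β` stopped before `discreteVar` exceeds the level `c`. -/
noncomputable def stoppedVar (c : ℝ) (s β : ℕ → EuclideanSpace ℝ (Fin d)) (j : ℕ) : ℝ :=
  ∑ i ∈ Finset.range j, if discreteVar s β (i + 1) ≤ c then ‖β (i + 1) - β i‖ else 0

theorem discreteVar_mono (s β : ℕ → EuclideanSpace ℝ (Fin d)) : Monotone (discreteVar s β) :=
  monotone_nat_of_le_succ fun j => by
    rw [discreteVar, discreteVar, Finset.sum_range_succ]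
    exact le_add_of_nonneg_right (by positivity)

theorem norm_discretePortfolio_le (x : EuclideanSpace ℝ (Fin d))
    (s β : ℕ → EuclideanSpace ℝ (Fin d)) (j : ℕ) :
    ‖discretePortfolio x s β j‖ ≤ ‖x‖ + discreteVar s β j := by
  refine (norm_add_le _ _).trans (add_le_add le_rfl ((norm_sum_le _ _).trans ?_))
  exact Finset.sum_le_sum fun i _ => le_add_of_nonneg_right (norm_nonneg _)

theorem stoppedVar_nonneg (c : ℝ) (s β : ℕ → EuclideanSpace ℝ (Fin d)) (j : ℕ) :
    0 ≤ stoppedVar c s β j :=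
  Finset.sum_nonneg fun i _ => by split_ifs <;> positivity

theorem norm_sub_le_discreteVar (s β : ℕ → EuclideanSpace ℝ (Fin d)) (j : ℕ) :
    ‖β (j + 1) - β j‖ ≤ discreteVar s β (j + 1) := by
  have h : 0 ≤ discreteVar s β j := by
    simpa [discreteVar] using discreteVar_mono s β (Nat.zero_le j)
  rw [discreteVar, Finset.sum_range_succ, ← discreteVar]
  have := norm_nonneg (quotient (β (j + 1) - β j) (s (j + 1)))
  linarith

theorem stoppedVar_le {c : ℝ} (hc : 0 ≤ c) (s β : ℕ → EuclideanSpace ℝ (Fin d)) (j : ℕ) :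
    stoppedVar c s β j ≤ c * j := by
  rw [stoppedVar]
  calc _ ≤ ∑ _i ∈ Finset.range j, c := Finset.sum_le_sum fun _ _ => by
        split_ifs with h
        · exact (norm_sub_le_discreteVar s β _).trans h
        · exact hc
    _ = c * j := by simp [mul_comm]

theorem stoppedVar_eq {c : ℝ} {s β : ℕ → EuclideanSpace ℝ (Fin d)} {j : ℕ}
    (h : discreteVar s β j ≤ c) :
    stoppedVar c s β j = ∑ i ∈ Finset.range j, ‖β (i + 1) - β i‖ :=
  Finset.sum_congr rfl fun _ hi =>
    if_pos ((discreteVar_mono s β (Finset.mem_range.1 hi)).trans h)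

variable {Ω : Type*} [mΩ : MeasurableSpace Ω] {P : Measure Ω} {𝓗 : Filtration ℕ mΩ}
  {s β ζ : ℕ → Ω → EuclideanSpace ℝ (Fin d)}

theorem measurable_discretePortfolio (hs : Adapted 𝓗 s) (hβ : Adapted 𝓗 β)
    (x : EuclideanSpace ℝ (Fin d)) (j : ℕ) :
    Measurable[𝓗 j] fun ω => discretePortfolio x (s · ω) (β · ω) j := by
  refine measurable_const.add (Finset.measurable_sum _ fun i hi => ?_)
  have hi' : i + 1 ≤ j := Finset.mem_range.1 hi
  exact measurable_quotient (((hβ (i + 1)).mono (𝓗.mono hi') le_rfl).sub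
    ((hβ i).mono (𝓗.mono (Nat.le_of_succ_le hi')) le_rfl))
    ((hs (i + 1)).mono (𝓗.mono hi') le_rfl)

theorem measurable_discreteVar (hs : Adapted 𝓗 s) (hβ : Adapted 𝓗 β) (j : ℕ) :
    Measurable[𝓗 j] fun ω => discreteVar (s · ω) (β · ω) j := by
  refine Finset.measurable_sum _ fun i hi => ?_
  have hi' : i + 1 ≤ j := Finset.mem_range.1 hi
  have hd : Measurable[𝓗 j] fun ω => β (i + 1) ω - β i ω :=
    ((hβ (i + 1)).mono (𝓗.mono hi') le_rfl).sub
      ((hβ i).mono (𝓗.mono (Nat.le_of_succ_le hi')) le_rfl)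
  exact (measurable_norm.comp
    (measurable_quotient hd ((hs (i + 1)).mono (𝓗.mono hi') le_rfl))).add
    (measurable_norm.comp hd)

theorem measurable_stoppedIncrement (hs : Adapted 𝓗 s) (hβ : Adapted 𝓗 β) (c : ℝ) (i : ℕ) :
    Measurable[𝓗 (i + 1)] fun ω =>
      if discreteVar (s · ω) (β · ω) (i + 1) ≤ c then ‖β (i + 1) ω - β i ω‖ else 0 :=
  Measurable.ite (measurable_discreteVar hs hβ (i + 1) measurableSet_Iic)
    (measurable_norm.comp ((hβ (i + 1)).sub ((hβ i).mono (𝓗.mono (Nat.le_succ i)) le_rfl)))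
    measurable_const

theorem measurable_stoppedVar (hs : Adapted 𝓗 s) (hβ : Adapted 𝓗 β) (c : ℝ) (j : ℕ) :
    Measurable[𝓗 j] fun ω => stoppedVar c (s · ω) (β · ω) j :=
  Finset.measurable_sum _ fun i hi =>
    (measurable_stoppedIncrement hs hβ c i).mono (𝓗.mono (Finset.mem_range.1 hi)) le_rfl

end Discrete

/-! ### The discrete-time supermartingale estimate -/

section DiscreteEstimate

variable {Ω : Type*} [mΩ : MeasurableSpace Ω] {P : Measure Ω} {d : ℕ}
  [NeZero d] {𝓗 : Filtration ℕ mΩ} {s β ζ : ℕ → Ω → EuclideanSpace ℝ (Fin d)}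
  {K : ProperCone ℝ (EuclideanSpace ℝ (Fin d))} {ε : ℝ}

/-- A discrete-time `ε`-consistent price system `ζ` for the prices `s`, together with
`K`-decreasing trades `β`. -/
structure IsDiscreteMarket (P : Measure Ω) (𝓗 : Filtration ℕ mΩ)
    (K : ProperCone ℝ (EuclideanSpace ℝ (Fin d))) (ε : ℝ)
    (s β ζ : ℕ → Ω → EuclideanSpace ℝ (Fin d)) : Prop where
  martingale : Martingale ζ 𝓗 P
  adapted_price : Adapted 𝓗 s
  adapted_trade : Adapted 𝓗 β
  pos : ∀ j, ∀ᵐ ω ∂P, ∀ i, 0 < s j ω i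
  numeraire : ∀ j, ∀ᵐ ω ∂P, s j ω 0 = 1
  nonneg : ∀ j, ∀ᵐ ω ∂P, ∀ i, 0 ≤ ζ j ω i
  mem_dual : ∀ j, ∀ᵐ ω ∂P, quotient (ζ j ω) (s j ω) ∈ dualCone K
  interior : ∀ j, ∀ᵐ ω ∂P, ∀ y ∈ K,
    ε * ‖quotient (ζ j ω) (s j ω)‖ * ‖y‖ ≤ ⟪quotient (ζ j ω) (s j ω), y⟫_ℝ
  decreasing : ∀ j, ∀ᵐ ω ∂P, β j ω - β (j + 1) ω ∈ K

theorem inner_single_zero (z : EuclideanSpace ℝ (Fin d)) :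
    ⟪z, EuclideanSpace.single 0 1⟫_ℝ = z 0 := by
  simp [EuclideanSpace.inner_single_right]

namespace IsDiscreteMarket

variable (h : IsDiscreteMarket P 𝓗 K ε s β ζ)
include h

/-- Each trade costs at least ε ζ¹ times its size: the interior condition is applied to the negated
trade in K, and |ζ/s| dominates its first entry, which is ζ¹ since the numeraire has price 1. -/
theorem ae_inner_increment_le (hε : 0 ≤ ε) (j : ℕ) : ∀ᵐ ω ∂P,
    ⟪ζ (j + 1) ω, quotient (β (j + 1) ω - β j ω) (s (j + 1) ω)⟫_ℝ +
      ε * (‖β (j + 1) ω - β j ω‖ * ζ (j + 1) ω 0) ≤ 0 := by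
  filter_upwards [h.nonneg (j + 1), h.numeraire (j + 1), h.interior (j + 1), h.decreasing j]
    with ω h1 h2 h3 h4
  have h5 := h3 _ h4
  have h6 : ζ (j + 1) ω 0 ≤ ‖quotient (ζ (j + 1) ω) (s (j + 1) ω)‖ := by
    have := abs_apply_le_norm (quotient (ζ (j + 1) ω) (s (j + 1) ω)) 0
    rw [show (quotient (ζ (j + 1) ω) (s (j + 1) ω)) 0 = ζ (j + 1) ω 0 / s (j + 1) ω 0 from rfl,
      h2, div_one] at this
    exact (le_abs_self _).trans this
  rw [inner_quotient_right]
  rw [← neg_sub, norm_neg, inner_neg_right] at h5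
  have h7 : ε * (‖β (j + 1) ω - β j ω‖ * ζ (j + 1) ω 0) ≤
      ε * ‖quotient (ζ (j + 1) ω) (s (j + 1) ω)‖ * ‖β (j + 1) ω - β j ω‖ := by
    rw [mul_assoc, mul_comm ‖quotient _ _‖]
    gcongr
  linarith

variable [IsFiniteMeasure P]

/-- The discrete-time estimate of the stopped variation, with a running remainder. -/
theorem stoppedVar_estimate_aux (hε : 0 ≤ ε) {c : ℝ} (hc : 0 ≤ c)
    {x : EuclideanSpace ℝ (Fin d)} {k : ℕ} {ρ : Ω → ℝ} (hρm : Measurable ρ) (hρ0 : ∀ ω, 0 ≤ ρ ω)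
    (hρC : ∀ ω, ρ ω ≤ ‖x‖ + c)
    (hρ : ∀ j < k, ∀ᵐ ω ∂P,
      min (‖x‖ + c) (shortfall K (s (j + 1) ω) (discretePortfolio x (s · ω) (β · ω) j)) ≤ ρ ω)
    (j : ℕ) (hj : j ≤ k) :
    ∫ ω, ⟪ζ j ω, if discreteVar (s · ω) (β · ω) j ≤ c then
        discretePortfolio x (s · ω) (β · ω) j else 0⟫_ℝ ∂P +
      ε * ∫ ω, ⟪ζ k ω, stoppedVar c (s · ω) (β · ω) j • EuclideanSpace.single 0 (1 : ℝ)⟫_ℝ ∂P ≤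
    ∫ ω, ⟪ζ 0 ω, x⟫_ℝ ∂P +
      ∫ ω, ⟪ζ k ω, (if discreteVar (s · ω) (β · ω) j ≤ c then 0 else ρ ω) • ones d⟫_ℝ ∂P := by
  induction j with
  | zero => simp [discreteVar, discretePortfolio, stoppedVar, hc]
  | succ j ih =>
    have ih := ih (Nat.le_of_succ_le hj)
    set V : ℕ → Ω → ℝ := fun j ω => discreteVar (s · ω) (β · ω) j with hV
    set W : ℕ → Ω → EuclideanSpace ℝ (Fin d) :=
      fun j ω => discretePortfolio x (s · ω) (β · ω) j with hW
    set C : ℝ := ‖x‖ + c with hC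
    have hC0 : 0 ≤ C := by positivity
    have hVm (j) : Measurable[𝓗 j] (V j) := measurable_discreteVar h.adapted_price
      h.adapted_trade j
    have hWm (j) : Measurable[𝓗 j] (W j) := measurable_discretePortfolio h.adapted_price
      h.adapted_trade x j
    have hV_le (ω) : V j ω ≤ V (j + 1) ω := discreteVar_mono _ _ (Nat.le_succ j)
    have hWC (j ω) (hω : V j ω ≤ c) : ‖W j ω‖ ≤ C :=
      (norm_discretePortfolio_le x _ _ j).trans (add_le_add le_rfl hω)
    have hW_succ (ω) : W (j + 1) ω =
        W j ω + quotient (β (j + 1) ω - β j ω) (s (j + 1) ω) := by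
      simp only [hW, discretePortfolio, Finset.sum_range_succ, add_assoc]
    let a : ℕ → Ω → EuclideanSpace ℝ (Fin d) := fun j ω => if V j ω ≤ c then W j ω else 0
    let q : Ω → EuclideanSpace ℝ (Fin d) := fun ω =>
      (if V (j + 1) ω ≤ c then ‖β (j + 1) ω - β j ω‖ else 0) • EuclideanSpace.single 0 1
    -- The defect is paid only at the step where the variation crosses c. The position held before
    -- that trade is valued at the prices of the crossing date.
    let r : Ω → ℝ := fun ω => if V j ω ≤ c then (if V (j + 1) ω ≤ c then 0 else
      min C (shortfall K (s (j + 1) ω) (W j ω))) else 0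
    -- Prices are positive only almost surely, so nonnegativity is forced in order to have a bound
    -- at every ω.
    let r' : Ω → ℝ := fun ω => max 0 (r ω)
    have ham (j) : StronglyMeasurable[𝓗 j] (a j) :=
      (Measurable.ite (hVm j measurableSet_Iic) (hWm j) measurable_const).stronglyMeasurable
    have haC (j ω) : ‖a j ω‖ ≤ C := by
      simp only [a]
      split_ifs with h1
      · exact hWC j ω h1
      · simpa using hC0
    have hqm : StronglyMeasurable[𝓗 (j + 1)] q :=
      ((measurable_stoppedIncrement h.adapted_price h.adapted_trade c j).smul_const
        _).stronglyMeasurable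
    have hqC (ω) : ‖q ω‖ ≤ c := by
      simp only [q, norm_smul]
      split_ifs with h1
      · simpa using (norm_sub_le_discreteVar _ _ j).trans h1
      · simpa using hc
    have hrm : Measurable[𝓗 (j + 1)] r :=
      Measurable.ite ((hVm j).mono (𝓗.mono (Nat.le_succ j)) le_rfl measurableSet_Iic)
        (Measurable.ite (hVm (j + 1) measurableSet_Iic) measurable_const
          (measurable_const.min (measurable_shortfall K (h.adapted_price (j + 1))
            ((hWm j).mono (𝓗.mono (Nat.le_succ j)) le_rfl)))) measurable_const
    have hum : StronglyMeasurable[𝓗 (j + 1)] fun ω => r' ω • ones d :=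
      ((measurable_const.max hrm).smul_const _).stronglyMeasurable
    have hr'C (ω) : r' ω ≤ C := by
      simp only [r', r]
      refine max_le hC0 ?_
      split_ifs
      exacts [hC0, min_le_left _ _, hC0]
    have huC (ω) : ‖r' ω • ones d‖ ≤ C * ‖ones d‖ := by
      rw [norm_smul, Real.norm_eq_abs, abs_of_nonneg (le_max_left _ _)]
      gcongr
      exact hr'C ω
    have hint {l i : ℕ} {f : Ω → EuclideanSpace ℝ (Fin d)} (hf : StronglyMeasurable[𝓗 i] f)
        {D : ℝ} (hD : ∀ ω, ‖f ω‖ ≤ D) : Integrable (fun ω => ⟪ζ l ω, f ω⟫_ℝ) P :=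
      integrable_inner_of_bounded (h.martingale.integrable l)
        (hf.mono (𝓗.le i)).aestronglyMeasurable hD
    have hstep : ∫ ω, ⟪ζ (j + 1) ω, a (j + 1) ω⟫_ℝ ∂P + ε * ∫ ω, ⟪ζ (j + 1) ω, q ω⟫_ℝ ∂P ≤
        ∫ ω, ⟪ζ (j + 1) ω, a j ω⟫_ℝ ∂P + ∫ ω, ⟪ζ (j + 1) ω, r' ω • ones d⟫_ℝ ∂P := by
      rw [← integral_const_mul, ← integral_add (hint (ham _) (haC _))
        ((hint hqm hqC).const_mul ε), ← integral_add (hint (ham j) (haC j)) (hint hum huC)]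
      refine integral_mono_ae ((hint (ham _) (haC _)).add ((hint hqm hqC).const_mul ε))
        ((hint (ham j) (haC j)).add (hint hum huC)) ?_
      -- Three cases: still below c, where the trade pays for its variation; crossing c, where
      -- dropping the old position costs at most its shortfall; already above c, where nothing is
      -- held.
      filter_upwards [h.ae_inner_increment_le hε j, h.pos (j + 1), h.nonneg (j + 1),
        h.mem_dual (j + 1)] with ω h1 h2 h3 h4
      have h5 : 0 ≤ ⟪ζ (j + 1) ω, r' ω • ones d⟫_ℝ := by
        rw [inner_smul_right]
        exact mul_nonneg (le_max_left _ _) (inner_ones_nonneg h3)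
      rw [inner_smul_right] at h5
      by_cases h6 : V (j + 1) ω ≤ c
      · have h7 : V j ω ≤ c := (hV_le ω).trans h6
        simp only [a, q, h6, h7, if_true, inner_smul_right, inner_single_zero, hW_succ,
          inner_add_right]
        linarith
      · by_cases h7 : V j ω ≤ c
        · have h8 := neg_inner_le_min (K := K) h2 h3 h4 (hWC j ω h7)
          have h9 : r' ω = min C (shortfall K (s (j + 1) ω) (W j ω)) := by
            simp only [r', r, h6, h7, if_true, if_false]
            exact max_eq_right (le_min hC0 (shortfall_nonneg K h2 _))
          simp only [a, q, h6, h7, if_true, if_false, inner_smul_right, inner_zero_right,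
            zero_smul, h9]
          linarith
        · simp only [a, q, h6, h7, if_false, inner_zero_right, zero_smul, inner_smul_right]
          linarith
    -- The old position is moved back to date j for the induction, the variation and the defect
    -- forward to the common terminal date k.
    rw [h.martingale.integral_inner_eq (Nat.le_succ j) (ham j) (haC j),
      ← h.martingale.integral_inner_eq hj hqm hqC,
      ← h.martingale.integral_inner_eq hj hum huC] at hstep
    have hLm := (((measurable_stoppedVar h.adapted_price h.adapted_trade c j).smul_const
      (EuclideanSpace.single (0 : Fin d) (1 : ℝ)))).stronglyMeasurable
    have hLC (ω) : ‖stoppedVar c (s · ω) (β · ω) j • EuclideanSpace.single (0 : Fin d) (1 : ℝ)‖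
        ≤ c * j := by
      rw [norm_smul, Real.norm_eq_abs, abs_of_nonneg (stoppedVar_nonneg _ _ _ _)]
      simpa using stoppedVar_le hc _ _ j
    have hL : ∫ ω, ⟪ζ k ω, stoppedVar c (s · ω) (β · ω) (j + 1) •
          EuclideanSpace.single 0 (1 : ℝ)⟫_ℝ ∂P =
        ∫ ω, ⟪ζ k ω, stoppedVar c (s · ω) (β · ω) j • EuclideanSpace.single 0 (1 : ℝ)⟫_ℝ ∂P +
          ∫ ω, ⟪ζ k ω, q ω⟫_ℝ ∂P := by
      rw [← integral_add (hint hLm hLC) (hint hqm hqC)]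
      refine integral_congr_ae (ae_of_all _ fun ω => ?_)
      simp only [q, ← inner_add_right, ← add_smul, stoppedVar, Finset.sum_range_succ, hV]
    have hRint (j) : Integrable (fun ω => ⟪ζ k ω,
        (if V j ω ≤ c then 0 else ρ ω) • ones d⟫_ℝ) P := by
      refine integrable_inner_of_bounded (C := C * ‖ones d‖) (h.martingale.integrable k)
        ((Measurable.ite ((hVm j).mono (𝓗.le j) le_rfl measurableSet_Iic) measurable_const
          hρm).smul_const _).aestronglyMeasurable fun ω => ?_
      rw [norm_smul]
      gcongr
      split_ifs
      · simpa using hC0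
      · rw [Real.norm_eq_abs, abs_of_nonneg (hρ0 ω)]
        exact hρC ω
    -- The variable ρ need not be adapted, so it may replace the adapted defect only now that the
    -- latter is paired with ζ k. The crossing happens once, hence ρ is charged once.
    have hR : ∫ ω, ⟪ζ k ω, (if V j ω ≤ c then 0 else ρ ω) • ones d⟫_ℝ ∂P +
        ∫ ω, ⟪ζ k ω, r' ω • ones d⟫_ℝ ∂P ≤
        ∫ ω, ⟪ζ k ω, (if V (j + 1) ω ≤ c then 0 else ρ ω) • ones d⟫_ℝ ∂P := by
      rw [← integral_add (hRint j) (hint hum huC)]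
      refine integral_mono_ae ((hRint j).add (hint hum huC)) (hRint (j + 1)) ?_
      filter_upwards [hρ j hj, h.nonneg k] with ω h1 h2
      simp only [inner_smul_right, ← add_mul]
      refine mul_le_mul_of_nonneg_right ?_ (inner_ones_nonneg h2)
      have h3 := hV_le ω
      by_cases h6 : V (j + 1) ω ≤ c
      · simp [r', r, h6, h3.trans h6]
      · by_cases h7 : V j ω ≤ c
        · simp only [r', r, h6, h7, if_true, if_false, zero_add]
          exact max_le (hρ0 ω) h1
        · simp [r', r, h6, h7]
    rw [hL, mul_add]
    linarith

/-- The discrete-time estimate of the stopped variation. -/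
theorem stoppedVar_estimate (hε : 0 ≤ ε) {c : ℝ} (hc : 0 ≤ c)
    {x : EuclideanSpace ℝ (Fin d)} {k : ℕ} {ρ : Ω → ℝ} (hρm : Measurable ρ) (hρ0 : ∀ ω, 0 ≤ ρ ω)
    (hρC : ∀ ω, ρ ω ≤ ‖x‖ + c)
    (hρ : ∀ j < k, ∀ᵐ ω ∂P,
      min (‖x‖ + c) (shortfall K (s (j + 1) ω) (discretePortfolio x (s · ω) (β · ω) j)) ≤ ρ ω)
    (hρk : ∀ᵐ ω ∂P,
      min (‖x‖ + c) (shortfall K (s k ω) (discretePortfolio x (s · ω) (β · ω) k)) ≤ ρ ω) :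
    ε * ∫ ω, ζ k ω 0 * stoppedVar c (s · ω) (β · ω) k ∂P ≤
      ∫ ω, ⟪ζ 0 ω, x⟫_ℝ ∂P + ∫ ω, ⟪ζ k ω, ones d⟫_ℝ * ρ ω ∂P := by
  have h1 := h.stoppedVar_estimate_aux hε hc hρm hρ0 hρC hρ k le_rfl
  simp only [inner_smul_right (_ : EuclideanSpace ℝ (Fin d)), inner_single_zero] at h1
  have hVm := (measurable_discreteVar h.adapted_price h.adapted_trade k).mono (𝓗.le k) le_rfl
  have hWm := (measurable_discretePortfolio h.adapted_price h.adapted_trade x k).mono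
    (𝓗.le k) le_rfl
  have hWC : ∀ ω, discreteVar (s · ω) (β · ω) k ≤ c →
      ‖discretePortfolio x (s · ω) (β · ω) k‖ ≤ ‖x‖ + c := fun ω hω =>
    (norm_discretePortfolio_le x _ _ k).trans (add_le_add le_rfl hω)
  have hI1 : Integrable (fun ω => ⟪ζ k ω, if discreteVar (s · ω) (β · ω) k ≤ c then
      discretePortfolio x (s · ω) (β · ω) k else 0⟫_ℝ) P := by
    refine integrable_inner_of_bounded (C := ‖x‖ + c) (h.martingale.integrable k)
      (Measurable.ite (hVm measurableSet_Iic) hWm measurable_const).aestronglyMeasurable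
      fun ω => ?_
    split_ifs with h1
    · exact hWC ω h1
    · simp only [norm_zero]
      positivity
  have hones : Integrable (fun ω => ⟪ζ k ω, ones d⟫_ℝ) P :=
    (h.martingale.integrable k).inner_const _
  have hbd {f : Ω → ℝ} (hfm : Measurable f) (hf : ∀ ω, |f ω| ≤ ‖x‖ + c) :
      Integrable (fun ω => f ω * ⟪ζ k ω, ones d⟫_ℝ) P :=
    hones.bdd_mul hfm.aestronglyMeasurable (ae_of_all _ hf)
  have hI2 := hbd hρm fun ω => (abs_of_nonneg (hρ0 ω)).trans_le (hρC ω)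
  have hI3 : Integrable (fun ω => (if discreteVar (s · ω) (β · ω) k ≤ c then 0 else ρ ω) *
      ⟪ζ k ω, ones d⟫_ℝ) P := by
    refine hbd (Measurable.ite (hVm measurableSet_Iic) measurable_const hρm) fun ω => ?_
    split_ifs
    · simp only [abs_zero]
      positivity
    · exact (abs_of_nonneg (hρ0 ω)).trans_le (hρC ω)
  -- If c was never crossed, ρ has not yet been charged and pays for the possible insolvency of the
  -- terminal position.
  have h2 : ∫ ω, (if discreteVar (s · ω) (β · ω) k ≤ c then 0 else ρ ω) *
      ⟪ζ k ω, ones d⟫_ℝ ∂P ≤ ∫ ω, ρ ω * ⟪ζ k ω, ones d⟫_ℝ ∂P +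
        ∫ ω, ⟪ζ k ω, if discreteVar (s · ω) (β · ω) k ≤ c then
          discretePortfolio x (s · ω) (β · ω) k else 0⟫_ℝ ∂P := by
    rw [← integral_add hI2 hI1]
    refine integral_mono_ae hI3 (hI2.add hI1) ?_
    filter_upwards [hρk, h.pos k, h.nonneg k, h.mem_dual k] with ω h1 h2 h3 h4
    have h0 := inner_ones_nonneg h3
    split_ifs with h5
    · have h6 := neg_inner_le_min (K := K) h2 h3 h4 (hWC ω h5)
      have h7 := mul_le_mul_of_nonneg_left h1 h0
      linarith
    · simp
  simp only [mul_comm (ζ k _ 0), mul_comm ⟪ζ k _, ones d⟫_ℝ]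
  linarith

end IsDiscreteMarket

end DiscreteEstimate

/-! ### Pathwise approximation of the portfolio -/

section Paths

variable {T : ℝ} {d : ℕ}

theorem eVariationOn_apply_le (f : Time T → EuclideanSpace ℝ (Fin d)) (i : Fin d) :
    eVariationOn (fun t => f t i) univ ≤ eVariationOn f univ := by
  refine iSup_le fun ⟨k, u, hu, hmem⟩ => le_trans (Finset.sum_le_sum fun j _ => ?_)
    (eVariationOn.sum_le hu hmem)
  exact PiLp.edist_apply_le (f (u (j + 1))) (f (u j)) i

theorem norm_quotient_le {s : EuclideanSpace ℝ (Fin d)} (hs : ∀ i, 0 < s i)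
    (b : EuclideanSpace ℝ (Fin d)) : ‖quotient b s‖ ≤ (∑ i, 1 / s i) * ‖b‖ := by
  refine (norm_le_sum_abs _).trans ?_
  rw [Finset.sum_mul]
  refine Finset.sum_le_sum fun i _ => ?_
  rw [show (quotient b s) i = b i / s i from rfl, abs_div, abs_of_pos (hs i),
    div_eq_mul_one_div, mul_comm]
  have := (hs i).le
  gcongr
  exact abs_apply_le_norm b i

variable {S B : Time T → EuclideanSpace ℝ (Fin d)}

theorem continuous_one_div_coord (hS : Continuous S) (hpos : ∀ t i, 0 < S t i) (i : Fin d) :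
    Continuous fun t => 1 / S t i :=
  continuous_const.div ((EuclideanSpace.proj (𝕜 := ℝ) i).continuous.comp hS)
    fun t => (hpos t i).ne'

variable [hT : Fact (0 < T)]

theorem totalVar_le (f : Time T → EuclideanSpace ℝ (Fin d)) :
    totalVar f ≤ d * euclideanVar f := by
  rw [totalVar, euclideanVar]
  calc _ ≤ ∑ _i : Fin d, (‖f (startTime T)‖ₑ + eVariationOn f univ) :=
        Finset.sum_le_sum fun i _ => add_le_add
          (PiLp.enorm_apply_le (f (startTime T)) i) (eVariationOn_apply_le f i)
    _ = _ := by simp [mul_add]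

/-- Paths that decrease along a cone have bounded variation if the cone is uniformly positive for
some linear functional. -/
theorem boundedVariationOn_of_decreasing {E : Type*} [NormedAddCommGroup E]
    [InnerProductSpace ℝ E] {K : Set E} {q : E} (hq : q ≠ 0) {ε : ℝ} (hε : 0 < ε)
    (hK : ∀ y ∈ K, ε * ‖q‖ * ‖y‖ ≤ ⟪q, y⟫_ℝ) {B : Time T → E}
    (hB : ∀ s t, s ≤ t → B s - B t ∈ K) : BoundedVariationOn B univ := by
  have hpos : 0 < ε * ‖q‖ := mul_pos hε (norm_pos_iff.2 hq)
  -- Increments of B are dominated in norm by decrements of this decreasing scalar function, so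
  -- variation sums telescope.
  let φ : Time T → ℝ := fun t => ⟪q, B t⟫_ℝ / (ε * ‖q‖)
  have hφ : ∀ s t, s ≤ t → ‖B t - B s‖ ≤ φ s - φ t := by
    intro s t hst
    have h := hK _ (hB s t hst)
    rw [← norm_neg, neg_sub, ← sub_div, ← inner_sub_right, le_div_iff₀ hpos, mul_comm]
    exact h
  have hanti : Antitone φ := fun s t hst => by
    have := (norm_nonneg _).trans (hφ s t hst)
    linarith
  refine ne_top_of_le_ne_top (ENNReal.ofReal_ne_top (r := φ (startTime T) - φ (endTime T)))
    (iSup_le fun ⟨k, u, hu, _⟩ => ?_)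
  calc ∑ i ∈ Finset.range k, edist (B (u (i + 1))) (B (u i))
      ≤ ∑ i ∈ Finset.range k, ENNReal.ofReal (φ (u i) - φ (u (i + 1))) :=
        Finset.sum_le_sum fun i _ => by
          rw [edist_dist, dist_eq_norm]
          exact ENNReal.ofReal_le_ofReal (hφ _ _ (hu (Nat.le_succ i)))
    _ = ENNReal.ofReal (φ (u 0) - φ (u k)) := by
        rw [← ENNReal.ofReal_sum_of_nonneg, Finset.sum_range_sub']
        exact fun i _ => sub_nonneg.2 (hanti (hu (Nat.le_succ i)))
    _ ≤ _ := by
        refine ENNReal.ofReal_le_ofReal ?_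
        have := hanti (startTime_le (u 0))
        have := hanti (le_endTime (u k))
        linarith

/-- The trading dates `0, 0, t₁, …, tₙ₊₁`: the initial transaction is executed at the second date,
so that the trades start from `0`. -/
noncomputable def tradeTime (T : ℝ) [Fact (0 < T)] (n j : ℕ) : Time T := grid T n (j - 1)

/-- The path `B` sampled along the trading dates, with the initial value `B_{0-} = 0`. -/
noncomputable def sampledTrade {E : Type*} [Zero E] (n : ℕ) (B : Time T → E) (j : ℕ) : E :=
  if j = 0 then 0 else B (tradeTime T n j)

theorem tradeTime_mono (n : ℕ) : Monotone (tradeTime T n) :=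
  fun _ _ hij => grid_mono n (Nat.sub_le_sub_right hij 1)

theorem tradeTime_zero (n : ℕ) : tradeTime T n 0 = startTime T := grid_zero n

theorem tradeTime_succ (n j : ℕ) : tradeTime T n (j + 1) = grid T n j := rfl

theorem tradeTime_eq_endTime {n j : ℕ} (h : n + 2 ≤ j) : tradeTime T n j = endTime T :=
  grid_eq_endTime (by lia)

theorem sampledTrade_zero {E : Type*} [Zero E] (n : ℕ) (B : Time T → E) :
    sampledTrade n B 0 = 0 := rfl

theorem sampledTrade_succ {E : Type*} [Zero E] (n : ℕ) (B : Time T → E) (j : ℕ) :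
    sampledTrade n B (j + 1) = B (grid T n j) := rfl

theorem sum_norm_sampledTrade (n k : ℕ) (B : Time T → EuclideanSpace ℝ (Fin d)) :
    ∑ j ∈ Finset.range (k + 1), ‖sampledTrade n B (j + 1) - sampledTrade n B j‖ =
      ‖B (startTime T)‖ +
        ∑ j ∈ Finset.range k, ‖B (grid T n (j + 1)) - B (grid T n j)‖ := by
  rw [Finset.sum_range_succ']
  simp only [sampledTrade_succ, sampledTrade_zero, zero_add, grid_zero, sub_zero]
  exact add_comm _ _

theorem euclideanVar_le_liminf {B : Time T → EuclideanSpace ℝ (Fin d)}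
    (hB : ∀ t, ContinuousWithinAt B (Ici t) t) :
    euclideanVar B ≤ liminf (fun n : ℕ => ENNReal.ofReal
      (∑ j ∈ Finset.range (n + 2), ‖sampledTrade n B (j + 1) - sampledTrade n B j‖)) atTop := by
  have h : ∀ n : ℕ, ENNReal.ofReal
      (∑ j ∈ Finset.range (n + 2), ‖sampledTrade n B (j + 1) - sampledTrade n B j‖) =
      ‖B (startTime T)‖ₑ +
        ∑ j ∈ Finset.range (n + 1), edist (B (grid T n j)) (B (grid T n (j + 1))) := by
    intro n
    rw [sum_norm_sampledTrade, ENNReal.ofReal_add (norm_nonneg _) (by positivity),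
      ofReal_norm, ENNReal.ofReal_sum_of_nonneg fun _ _ => norm_nonneg _]
    refine congrArg _ (Finset.sum_congr rfl fun j _ => ?_)
    rw [ofReal_norm, edist_comm, edist_eq_enorm_sub]
  simp_rw [h]
  rw [euclideanVar]
  refine (add_le_add le_rfl (eVariationOn_le_liminf_grid hB)).trans ?_
  exact (liminf_const_add atTop _ _ (by isBoundedDefault) (by isBoundedDefault)).ge

theorem exists_sum_one_div_le (hS : Continuous S) (hpos : ∀ t i, 0 < S t i) :
    ∃ M, 0 ≤ M ∧ ∀ t, ∑ i, 1 / S t i ≤ M := by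
  obtain ⟨M, hM⟩ := isCompact_univ.exists_bound_of_continuousOn
    (continuous_finsetSum Finset.univ fun i _ => continuous_one_div_coord hS hpos i).continuousOn
  exact ⟨M, (norm_nonneg _).trans (hM (startTime T) (mem_univ _)),
    fun t => (le_abs_self _).trans (hM t (mem_univ t))⟩

/-- The bound is uniform in the mesh, so on a given path a large level c is never crossed on any
grid. -/
theorem exists_discreteVar_le (hS : Continuous S) (hpos : ∀ t i, 0 < S t i)
    (hBV : BoundedVariationOn B univ) :
    ∃ M, ∀ n j, discreteVar (fun i => S (tradeTime T n i)) (sampledTrade n B) j ≤ M := by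
  obtain ⟨M, hM0, hM⟩ := exists_sum_one_div_le hS hpos
  refine ⟨(M + 1) * (‖B (startTime T)‖ + (eVariationOn B univ).toReal), fun n j => ?_⟩
  have h1 : ∑ i ∈ Finset.range (j + 1), ‖sampledTrade n B (i + 1) - sampledTrade n B i‖ ≤
      ‖B (startTime T)‖ + (eVariationOn B univ).toReal := by
    rw [sum_norm_sampledTrade]
    refine add_le_add le_rfl ?_
    rw [← ENNReal.ofReal_le_iff_le_toReal hBV,
      ENNReal.ofReal_sum_of_nonneg fun _ _ => norm_nonneg _]
    simp_rw [ofReal_norm, ← edist_eq_enorm_sub]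
    exact eVariationOn.sum_le (grid_mono n) fun i => mem_univ _
  refine (discreteVar_mono _ _ (Nat.le_succ j)).trans ?_
  refine le_trans ?_ (mul_le_mul_of_nonneg_left h1 (by positivity))
  rw [discreteVar, Finset.mul_sum]
  refine Finset.sum_le_sum fun i _ => ?_
  rw [add_mul, one_mul]
  refine add_le_add ((norm_quotient_le (hpos _) _).trans ?_) le_rfl
  gcongr
  exact hM _

/-- The continuous-time portfolio in physical units of a single path. -/
noncomputable def pathPortfolio (x : EuclideanSpace ℝ (Fin d))
    (S B : Time T → EuclideanSpace ℝ (Fin d)) (t : Time T) : EuclideanSpace ℝ (Fin d) :=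
  WithLp.toLp 2 fun i => x i + stieltjesIntegral (fun s => 1 / S s i) (fun s => B s i) t

/-- The initial trade is reproduced exactly; each later step adds a Riemann-sum error at most the
oscillation C of 1/S times the variation over that step, and these variations add up. -/
theorem abs_discretePortfolio_sub_pathPortfolio_le (hS : Continuous S)
    (hpos : ∀ t i, 0 < S t i) (hB : ∀ t, ContinuousWithinAt B (Ici t) t)
    {i : Fin d} (hBV : BoundedVariationOn (fun t => B t i) univ)
    {n : ℕ} {C : ℝ} (hC : ∀ j, ∀ u ∈ Icc (grid T n j) (grid T n (j + 1)),
      |1 / S u i - 1 / S (grid T n (j + 1)) i| ≤ C)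
    (x : EuclideanSpace ℝ (Fin d)) (j : ℕ) :
    |discretePortfolio x (fun i => S (tradeTime T n i)) (sampledTrade n B) (j + 1) i -
      pathPortfolio x S B (grid T n j) i| ≤
      C * hBV.vectorMeasure.variation.real (Ioc (grid T n 0) (grid T n j)) := by
  have hBi : ∀ t, ContinuousWithinAt (fun t => B t i) (Ici t) t := fun t =>
    (EuclideanSpace.proj (𝕜 := ℝ) i).continuous.continuousAt.comp_continuousWithinAt (hB t)
  have hpath : ∀ t, pathPortfolio x S B t i =
      x i + stieltjesIntegral (fun s => 1 / S s i) (fun s => B s i) t := fun t => rfl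
  have hdisc : ∀ j, discretePortfolio x (fun i => S (tradeTime T n i)) (sampledTrade n B)
      (j + 1) i = discretePortfolio x (fun i => S (tradeTime T n i)) (sampledTrade n B) j i +
      1 / S (grid T n j) i * (B (grid T n j) i - sampledTrade n B j i) := by
    intro j
    simp only [discretePortfolio, Finset.sum_range_succ, ← add_assoc]
    rw [PiLp.add_apply, sampledTrade_succ, tradeTime_succ]
    simp only [quotient, PiLp.sub_apply]
    ring
  induction j with
  | zero =>
    rw [hdisc, hpath, grid_zero, stieltjesIntegral_startTime hBV hBi]
    simp [discretePortfolio, sampledTrade_zero]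
  | succ j ih =>
    have h1 := abs_stieltjesIntegral_sub_sub_le (continuous_one_div_coord hS hpos i) hBV hBi
      (grid_mono n (Nat.le_succ j)) (hC j)
    have h2 : hBV.vectorMeasure.variation.real (Ioc (grid T n 0) (grid T n (j + 1))) =
        hBV.vectorMeasure.variation.real (Ioc (grid T n 0) (grid T n j)) +
        hBV.vectorMeasure.variation.real (Ioc (grid T n j) (grid T n (j + 1))) := by
      rw [← measureReal_union (by grind) measurableSet_Ioc,
        Ioc_union_Ioc_eq_Ioc (grid_mono n (Nat.zero_le j)) (grid_mono n (Nat.le_succ j))]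
    rw [hdisc, hpath, h2, mul_add]
    rw [hpath] at ih
    rw [sampledTrade_succ]
    rw [abs_le] at ih h1 ⊢
    constructor <;> linarith [ih.1, ih.2, h1.1, h1.2]

theorem exists_forall_shortfall_le {K : ProperCone ℝ (EuclideanSpace ℝ (Fin d))}
    (hS : Continuous S) (hpos : ∀ t i, 0 < S t i) (hS0 : ∀ i, S (startTime T) i = 1)
    (hB : ∀ t, ContinuousWithinAt B (Ici t) t) (hBV : BoundedVariationOn B univ)
    {x : EuclideanSpace ℝ (Fin d)} (hx : x ∈ K)
    (hV : ∀ n j, hadamard (S (grid T n j)) (pathPortfolio x S B (grid T n j)) ∈ K)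
    {η : ℝ} (hη : 0 < η) :
    ∃ N, ∀ n ≥ N, ∀ j, shortfall K (S (tradeTime T n (j + 1)))
      (discretePortfolio x (fun i => S (tradeTime T n i)) (sampledTrade n B) j) ≤ η := by
  have hBVi : ∀ i, BoundedVariationOn (fun t => B t i) univ := fun i =>
    ne_top_of_le_ne_top hBV (eVariationOn_apply_le B i)
  obtain ⟨M₁, hM₁0, hM₁⟩ := exists_sum_one_div_le hS hpos
  choose m hm using fun i => exists_abs_stieltjesIntegral_le
    (continuous_one_div_coord hS hpos i) (hBVi i)
  obtain ⟨M₃, hM₃⟩ := isCompact_univ.exists_bound_of_continuousOn hS.continuousOn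
  have hM₃0 : 0 ≤ M₃ := (norm_nonneg _).trans (hM₃ (startTime T) (mem_univ _))
  have hm0 : ∀ i, 0 ≤ m i := fun i => (abs_nonneg _).trans (hm i (startTime T))
  set v : Fin d → ℝ := fun i => (hBVi i).vectorMeasure.variation.real univ
  have hv0 : ∀ i, 0 ≤ v i := fun i => measureReal_nonneg
  -- The shortfall will be at most A times the common oscillation bound C of S and 1/S over a step;
  -- hence C = η / (A + 1), the 1 avoiding division by zero.
  set A : ℝ := M₁ * ∑ i, (M₃ * v i + (|x i| + m i)) with hA
  have hA0 : 0 ≤ A := mul_nonneg hM₁0 (Finset.sum_nonneg fun i _ => by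
    have := hv0 i
    have := hm0 i
    positivity)
  set C : ℝ := η / (A + 1) with hC
  have hC0 : 0 < C := by positivity
  have hg : UniformContinuous fun t => fun i => 1 / S t i :=
    CompactSpace.uniformContinuous_of_continuous
      (continuous_pi fun i => continuous_one_div_coord hS hpos i)
  obtain ⟨δ₁, hδ₁, h₁⟩ := Metric.uniformContinuous_iff.1 hg C hC0
  obtain ⟨δ₂, hδ₂, h₂⟩ := Metric.uniformContinuous_iff.1
    (CompactSpace.uniformContinuous_of_continuous hS) C hC0
  have hmesh : Tendsto (fun n : ℕ => T / ((n : ℝ) + 1)) atTop (𝓝 0) := by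
    simpa [div_eq_mul_one_div T] using tendsto_one_div_add_atTop_nhds_zero_nat.const_mul T
  obtain ⟨N, hN⟩ := eventually_atTop.1 (hmesh.eventually (gt_mem_nhds (lt_min hδ₁ hδ₂)))
  refine ⟨N, fun n hn j => ?_⟩
  have hdist : ∀ j, ∀ u ∈ Icc (grid T n j) (grid T n (j + 1)),
      dist u (grid T n (j + 1)) < min δ₁ δ₂ := fun j u hu =>
    ((dist_right_le_of_mem_Icc hu).trans (dist_grid_le n j)).trans_lt (hN n hn)
  have hgC : ∀ i, ∀ j, ∀ u ∈ Icc (grid T n j) (grid T n (j + 1)),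
      |1 / S u i - 1 / S (grid T n (j + 1)) i| ≤ C := fun i j u hu =>
    (dist_le_pi_dist (fun i => 1 / S u i) (fun i => 1 / S (grid T n (j + 1)) i) i).trans
      (h₁ ((hdist j u hu).trans_le (min_le_left _ _))).le
  have hSC : ∀ i, ∀ j, |S (grid T n (j + 1)) i - S (grid T n j) i| ≤ C := fun i j => by
    have := (h₂ ((hdist j _ (left_mem_Icc.2 (grid_mono n (Nat.le_succ j)))).trans_le
      (min_le_right _ _))).le
    rw [dist_comm, dist_eq_norm] at this
    exact (abs_apply_le_norm (S (grid T n (j + 1)) - S (grid T n j)) i).trans this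
  cases j with
  | zero =>
    -- Before any trade the position is x at unit prices, which is solvent.
    have h : hadamard (S (startTime T)) x = x := by
      ext i
      simp [hadamard, hS0]
    have h' : Metric.infDist x (K : Set (EuclideanSpace ℝ (Fin d))) = 0 :=
      Metric.infDist_zero_of_mem hx
    rw [tradeTime_succ, grid_zero]
    simpa [shortfall, discretePortfolio, h, h'] using hη.le
  | succ j =>
    set w := discretePortfolio x (fun i => S (tradeTime T n i)) (sampledTrade n B) (j + 1)
    have hw : ∀ i, |w i - pathPortfolio x S B (grid T n j) i| ≤ C * v i := fun i => by
      refine (abs_discretePortfolio_sub_pathPortfolio_le hS hpos hB (hBVi i) (hgC i) x j).trans ?_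
      gcongr
      exact measureReal_mono (subset_univ _)
    have hp : ∀ i, |pathPortfolio x S B (grid T n j) i| ≤ |x i| + m i := fun i =>
      (abs_add_le _ _).trans (add_le_add le_rfl (hm i _))
    have h3 : Metric.infDist (hadamard (S (grid T n (j + 1))) w) K ≤
        ∑ i, C * (M₃ * v i + (|x i| + m i)) := by
      refine (Metric.infDist_le_dist_of_mem (hV n j)).trans ?_
      rw [dist_eq_norm]
      refine (norm_le_sum_abs _).trans (Finset.sum_le_sum fun i _ => ?_)
      -- Comparison is with the solvent position one grid step earlier: one error from discretising
      -- the integral, one from the price move.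
      have h4 : (hadamard (S (grid T n (j + 1))) w -
          hadamard (S (grid T n j)) (pathPortfolio x S B (grid T n j))) i =
          S (grid T n (j + 1)) i * (w i - pathPortfolio x S B (grid T n j) i) +
          (S (grid T n (j + 1)) i - S (grid T n j) i) *
            pathPortfolio x S B (grid T n j) i := by
        simp only [hadamard, PiLp.sub_apply]
        ring
      rw [h4]
      refine (abs_add_le _ _).trans ?_
      rw [abs_mul, abs_mul, mul_add, ← mul_assoc C, mul_comm C, mul_assoc]
      refine add_le_add (mul_le_mul ((abs_apply_le_norm _ i).trans (hM₃ _ (mem_univ _))) (hw i)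
        (abs_nonneg _) hM₃0) (mul_le_mul (hSC i j) (hp i) (abs_nonneg _) hC0.le)
    rw [← Finset.mul_sum] at h3
    rw [shortfall, tradeTime_succ]
    calc _ ≤ M₁ * (C * ∑ i, (M₃ * v i + (|x i| + m i))) :=
          mul_le_mul (hM₁ _) h3 Metric.infDist_nonneg hM₁0
      _ = C * A := by rw [hA]; ring
      _ ≤ η := by
          rw [hC, div_mul_eq_mul_div, div_le_iff₀ (by positivity)]
          nlinarith

end Paths

/-! ### Passage to continuous time -/

section Market

/-- The ε-interior of K* tests against K**, and only the trivial inclusion K ⊆ K** is needed. -/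
theorem le_inner_of_mem_epsInterior {d : ℕ} {K : ProperCone ℝ (EuclideanSpace ℝ (Fin d))} {ε : ℝ}
    {q : EuclideanSpace ℝ (Fin d)}
    (hq : q ∈ epsInterior ε (dualCone K)) {y : EuclideanSpace ℝ (Fin d)} (hy : y ∈ K) :
    ε * ‖q‖ * ‖y‖ ≤ ⟪q, y⟫_ℝ := by
  by_cases h : y = 0
  · simp [h]
  · refine (hq y (mem_dualCone.2 fun k hk => ?_) h).le
    rw [real_inner_comm]
    exact mem_dualCone.1 hk y hy

variable {Ω : Type*} [mΩ : MeasurableSpace Ω] {P : Measure Ω} {T : ℝ} [Fact (0 < T)]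
  {d : ℕ} [NeZero d] {K : ProperCone ℝ (EuclideanSpace ℝ (Fin d))} {ε : ℝ}
  {𝓖 : Filtration (Time T) mΩ} {S Z B : Time T → Ω → EuclideanSpace ℝ (Fin d)}
  {x : EuclideanSpace ℝ (Fin d)}

/-- The information available at the trading dates. -/
noncomputable def sampledFiltration (𝓖 : Filtration (Time T) mΩ) (n : ℕ) : Filtration ℕ mΩ where
  seq j := 𝓖 (tradeTime T n j)
  mono' _ _ hij := 𝓖.mono (tradeTime_mono n hij)
  le' _ := 𝓖.le _

/-- A continuous-time market with an `ε`-consistent price system and an admissible strategy, for a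
filtration for which the price system is a martingale. -/
structure IsMarket (P : Measure Ω) (𝓖 : Filtration (Time T) mΩ)
    (K : ProperCone ℝ (EuclideanSpace ℝ (Fin d))) (ε : ℝ)
    (S Z B : Time T → Ω → EuclideanSpace ℝ (Fin d)) (x : EuclideanSpace ℝ (Fin d)) : Prop where
  price : IsPriceProcess P 𝓖 S
  martingale : Martingale Z 𝓖 P
  nonneg : ∀ t, ∀ᵐ ω ∂P, ∀ i, 0 ≤ Z t ω i
  mem_dual : ∀ t, ∀ᵐ ω ∂P, quotient (Z t ω) (S t ω) ∈ dualCone K ∧ quotient (Z t ω) (S t ω) ≠ 0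
  interior : ∀ t, ∀ᵐ ω ∂P, ∀ y ∈ K,
    ε * ‖quotient (Z t ω) (S t ω)‖ * ‖y‖ ≤ ⟪quotient (Z t ω) (S t ω), y⟫_ℝ
  mem_admissible : B ∈ admissible P 𝓖 K S x

namespace IsMarket

variable (h : IsMarket P 𝓖 K ε S Z B x)
include h

theorem isDiscreteMarket (n : ℕ) :
    IsDiscreteMarket P (sampledFiltration 𝓖 n) K ε (fun j => S (tradeTime T n j))
      (fun j ω => sampledTrade n (B · ω) j) (fun j => Z (tradeTime T n j)) where
  martingale := ⟨fun j => h.martingale.1 _, fun i j hij => h.martingale.2 _ _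
    (tradeTime_mono n hij)⟩
  adapted_price j := h.price.adapted _
  adapted_trade j := by
    by_cases hj : j = 0
    · simp [sampledTrade, hj]
    · simpa [sampledTrade, hj] using! h.mem_admissible.1.adapted (tradeTime T n j)
  pos j := h.price.pos.mono fun ω hω => hω _
  numeraire j := h.price.numeraire.mono fun ω hω => hω _
  nonneg j := h.nonneg _
  mem_dual j := (h.mem_dual _).mono fun ω hω => hω.1
  interior j := h.interior _
  decreasing j := by
    cases j with
    | zero =>
      filter_upwards [h.mem_admissible.1.initial] with ω hω
      simpa [sampledTrade_zero, sampledTrade_succ, grid_zero] using hω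
    | succ j =>
      filter_upwards [h.mem_admissible.1.decreasing] with ω hω
      exact hω _ _ (grid_mono n (Nat.le_succ j))

/-- The single vector Z_0/S_0 is uniformly positive on K, which suffices for the whole path. -/
theorem ae_boundedVariationOn (hε : 0 < ε) :
    ∀ᵐ ω ∂P, BoundedVariationOn (fun t => B t ω) univ := by
  filter_upwards [h.mem_dual (startTime T), h.interior (startTime T),
    h.mem_admissible.1.decreasing] with ω h1 h2 h3
  exact boundedVariationOn_of_decreasing (K := (K : Set (EuclideanSpace ℝ (Fin d)))) h1.2 hε h2 h3

/-- The stopped variation along the trading dates. -/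
noncomputable def gridVar (_h : IsMarket P 𝓖 K ε S Z B x) (c : ℝ) (n : ℕ) (ω : Ω) : ℝ :=
  stoppedVar c (fun j => S (tradeTime T n j) ω) (sampledTrade n (B · ω)) (n + 2)

/-- The truncated maximal shortfall along the trading dates. -/
noncomputable def gridShortfall (_h : IsMarket P 𝓖 K ε S Z B x) (c : ℝ) (n : ℕ) (ω : Ω) : ℝ :=
  (Finset.range (n + 2 + 1)).sup' Finset.nonempty_range_add_one fun j =>
    max 0 (min (‖x‖ + c) (shortfall K (S (tradeTime T n (j + 1)) ω)
      (discretePortfolio x (fun j => S (tradeTime T n j) ω) (sampledTrade n (B · ω)) j)))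

theorem measurable_gridVar (c : ℝ) (n : ℕ) : Measurable (h.gridVar c n) :=
  (measurable_stoppedVar (h.isDiscreteMarket n).adapted_price
    (h.isDiscreteMarket n).adapted_trade c (n + 2)).mono (Filtration.le _ _) le_rfl

theorem gridVar_nonneg (c : ℝ) (n : ℕ) (ω : Ω) : 0 ≤ h.gridVar c n ω :=
  stoppedVar_nonneg _ _ _ _

theorem measurable_gridShortfall (c : ℝ) (n : ℕ) : Measurable (h.gridShortfall c n) :=
  Finset.measurable_range_sup'' fun j _ => measurable_const.max (measurable_const.min
    (measurable_shortfall K ((h.price.adapted _).mono (𝓖.le _) le_rfl)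
      ((measurable_discretePortfolio (h.isDiscreteMarket n).adapted_price
        (h.isDiscreteMarket n).adapted_trade x j).mono (Filtration.le _ _) le_rfl)))

theorem gridShortfall_nonneg (c : ℝ) (n : ℕ) (ω : Ω) : 0 ≤ h.gridShortfall c n ω :=
  (Finset.le_sup'_iff Finset.nonempty_range_add_one).2
    ⟨0, Finset.mem_range.2 (Nat.succ_pos _), le_max_left _ _⟩

theorem gridShortfall_le {c : ℝ} (hc : 0 ≤ c) (n : ℕ) (ω : Ω) :
    h.gridShortfall c n ω ≤ ‖x‖ + c :=
  Finset.sup'_le _ _ fun _ _ => max_le (by positivity) (min_le_left _ _)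

theorem min_le_gridShortfall (c : ℝ) (n : ℕ) (ω : Ω) {j : ℕ} (hj : j ≤ n + 2) :
    min (‖x‖ + c) (shortfall K (S (tradeTime T n (j + 1)) ω)
      (discretePortfolio x (fun j => S (tradeTime T n j) ω) (sampledTrade n (B · ω)) j)) ≤
      h.gridShortfall c n ω :=
  (Finset.le_sup'_iff Finset.nonempty_range_add_one).2
    ⟨j, Finset.mem_range.2 (Nat.lt_succ_of_le hj), le_max_right _ _⟩

theorem ae_tendsto_gridShortfall (hε : 0 < ε) (hx : x ∈ K) (c : ℝ) :
    ∀ᵐ ω ∂P, Tendsto (fun n => h.gridShortfall c n ω) atTop (𝓝 0) := by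
  have hV : ∀ᵐ ω ∂P, ∀ n j, portfolio S x B (grid T n j) ω ∈ K :=
    ae_all_iff.2 fun n => ae_all_iff.2 fun j => h.mem_admissible.2 _
  filter_upwards [h.ae_boundedVariationOn hε, h.price.continuous, h.price.pos, h.price.initial,
    h.mem_admissible.1.rcll, hV] with ω h1 h2 h3 h4 h5 h6
  refine tendsto_order.2 ⟨fun a ha => Eventually.of_forall fun n =>
    ha.trans_le (h.gridShortfall_nonneg c n ω), fun a ha => ?_⟩
  obtain ⟨N, hN⟩ := exists_forall_shortfall_le h2 h3 h4 h5.1 h1 hx h6 (half_pos ha)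
  refine eventually_atTop.2 ⟨N, fun n hn => ?_⟩
  refine lt_of_le_of_lt (Finset.sup'_le _ _ fun j _ => ?_) (half_lt_self ha)
  exact max_le (half_pos ha).le ((min_le_right _ _).trans (hN n hn j))

theorem integrable_mul_gridVar {c : ℝ} (hc : 0 ≤ c) (n : ℕ) :
    Integrable (fun ω => Z (endTime T) ω 0 * h.gridVar c n ω) P := by
  have hZ : Integrable (fun ω => Z (endTime T) ω 0) P :=
    (EuclideanSpace.proj (𝕜 := ℝ) (0 : Fin d)).integrable_comp (h.martingale.integrable _)
  refine hZ.mul_bdd (c := c * (n + 2 : ℕ)) (h.measurable_gridVar c n).aestronglyMeasurable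
    (ae_of_all _ fun ω => ?_)
  rw [Real.norm_eq_abs, abs_of_nonneg (h.gridVar_nonneg c n ω)]
  exact stoppedVar_le hc _ _ _

theorem tendsto_integral_gridShortfall (hε : 0 < ε) (hx : x ∈ K) {c : ℝ} (hc : 0 ≤ c) :
    Tendsto (fun n => ∫ ω, ⟪Z (endTime T) ω, ones d⟫_ℝ * h.gridShortfall c n ω ∂P) atTop
      (𝓝 0) := by
  have hones : Integrable (fun ω => ⟪Z (endTime T) ω, ones d⟫_ℝ) P :=
    (h.martingale.integrable _).inner_const _
  have h1 := tendsto_integral_of_dominated_convergence (μ := P) (f := fun _ => (0 : ℝ))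
    (F := fun n ω => ⟪Z (endTime T) ω, ones d⟫_ℝ * h.gridShortfall c n ω)
    (fun ω => ‖⟪Z (endTime T) ω, ones d⟫_ℝ‖ * (‖x‖ + c))
    (fun n => hones.aestronglyMeasurable.mul
      (h.measurable_gridShortfall c n).aestronglyMeasurable)
    (hones.norm.mul_const _) (fun n => ae_of_all _ fun ω => ?_) ?_
  · simpa using h1
  · rw [norm_mul, Real.norm_eq_abs (h.gridShortfall c n ω),
      abs_of_nonneg (h.gridShortfall_nonneg c n ω)]
    gcongr
    exact h.gridShortfall_le hc n ω
  · filter_upwards [h.ae_tendsto_gridShortfall hε hx c] with ω hω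
    simpa using hω.const_mul ⟪Z (endTime T) ω, ones d⟫_ℝ

variable [IsFiniteMeasure P]

theorem gridVar_estimate (hε : 0 ≤ ε) {c : ℝ} (hc : 0 ≤ c) (n : ℕ) :
    ε * ∫ ω, Z (endTime T) ω 0 * h.gridVar c n ω ∂P ≤
      ∫ ω, ⟪Z (startTime T) ω, x⟫_ℝ ∂P +
        ∫ ω, ⟪Z (endTime T) ω, ones d⟫_ℝ * h.gridShortfall c n ω ∂P := by
  have h1 := (h.isDiscreteMarket n).stoppedVar_estimate hε hc (x := x) (k := n + 2)
    (h.measurable_gridShortfall c n) (h.gridShortfall_nonneg c n) (h.gridShortfall_le hc n)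
    (fun j hj => ae_of_all _ fun ω => h.min_le_gridShortfall c n ω hj.le)
    (ae_of_all _ fun ω => by
      have h2 := h.min_le_gridShortfall c n ω (le_refl (n + 2))
      -- Since 0 occurs twice among the trading dates, T is reached at index n + 2. The dates are
      -- constant from there on, so the index n + 3 in the shortfall still means T.
      rwa [tradeTime_eq_endTime (Nat.le_succ _), ← tradeTime_eq_endTime (le_refl (n + 2))] at h2)
  simp only [tradeTime_zero, tradeTime_eq_endTime (le_refl (n + 2))] at h1
  exact h1

/-- The weighted Euclidean variation of an admissible strategy is dominated by a measurable
function with an explicit bound for its expectation. -/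
theorem exists_measurable_majorant (hε : 0 < ε) (hx : x ∈ K) :
    ∃ R : Ω → ℝ≥0∞, Measurable R ∧
      (∀ᵐ ω ∂P, ENNReal.ofReal (ε * Z (endTime T) ω 0) * euclideanVar (B · ω) ≤ R ω) ∧
      ∫⁻ ω, R ω ∂P ≤ ENNReal.ofReal (∫ ω, ⟪Z (startTime T) ω, x⟫_ℝ ∂P) := by
  have hZm : Measurable fun ω => Z (endTime T) ω 0 :=
    measurable_coord ((h.martingale.1 (endTime T)).measurable.mono (𝓖.le _) le_rfl) 0
  let g : ℕ → ℕ → Ω → ℝ≥0∞ := fun c n ω =>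
    ENNReal.ofReal (ε * (Z (endTime T) ω 0 * h.gridVar c n ω))
  have hgm : ∀ c n, Measurable (g c n) := fun c n =>
    ((hZm.mul (h.measurable_gridVar c n)).const_mul ε).ennreal_ofReal
  have hgm' : ∀ c, Measurable fun ω => liminf (fun n => g c n ω) atTop := fun c =>
    Measurable.liminf (hgm c)
  refine ⟨fun ω => liminf (fun c => liminf (fun n => g c n ω) atTop) atTop,
    Measurable.liminf hgm', ?_, ?_⟩
  · filter_upwards [h.ae_boundedVariationOn hε, h.price.continuous, h.price.pos,
      h.mem_admissible.1.rcll, h.nonneg (endTime T)] with ω h1 h2 h3 h4 h5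
    obtain ⟨M, hM⟩ := exists_discreteVar_le h2 h3 h1
    refine le_liminf_of_le (by isBoundedDefault) ?_
    -- Beyond the pathwise bound M no truncation takes place, for all meshes at once.
    filter_upwards [eventually_ge_atTop ⌈M⌉₊] with c hc
    have h6 : ∀ n, g c n ω = ENNReal.ofReal (ε * Z (endTime T) ω 0) * ENNReal.ofReal
        (∑ j ∈ Finset.range (n + 2),
          ‖sampledTrade n (B · ω) (j + 1) - sampledTrade n (B · ω) j‖) := by
      intro n
      rw [← ENNReal.ofReal_mul (mul_nonneg hε.le (h5 0)), mul_assoc]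
      simp only [g, gridVar]
      rw [stoppedVar_eq ((hM n _).trans ((Nat.le_ceil M).trans (by exact_mod_cast hc)))]
    simp_rw [h6]
    rw [ENNReal.liminf_const_mul_of_ne_top ENNReal.ofReal_ne_top]
    gcongr
    exact euclideanVar_le_liminf h4.1
  · refine (lintegral_liminf_le hgm').trans ?_
    -- The bound obtained for a fixed c does not depend on c, so a single c suffices for the outer
    -- lower limit.
    refine liminf_le_of_le (by isBoundedDefault) fun b hb => ?_
    obtain ⟨c, hc⟩ := hb.exists
    refine hc.trans ((lintegral_liminf_le (hgm c)).trans ?_)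
    have hlim : Tendsto (fun n => ENNReal.ofReal (∫ ω, ⟪Z (startTime T) ω, x⟫_ℝ ∂P +
        ∫ ω, ⟪Z (endTime T) ω, ones d⟫_ℝ * h.gridShortfall c n ω ∂P)) atTop
        (𝓝 (ENNReal.ofReal (∫ ω, ⟪Z (startTime T) ω, x⟫_ℝ ∂P))) := by
      refine (ENNReal.continuous_ofReal.tendsto _).comp ?_
      simpa using tendsto_const_nhds.add
        (h.tendsto_integral_gridShortfall hε hx (Nat.cast_nonneg c))
    rw [← hlim.liminf_eq]
    refine liminf_le_liminf (Eventually.of_forall fun n => ?_)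
    simp only [g]
    rw [← ofReal_integral_eq_lintegral_ofReal
      ((h.integrable_mul_gridVar (Nat.cast_nonneg c) n).const_mul ε), integral_const_mul]
    · exact ENNReal.ofReal_le_ofReal (h.gridVar_estimate hε.le (Nat.cast_nonneg c) n)
    · filter_upwards [h.nonneg (endTime T)] with ω hω
      exact mul_nonneg hε.le (mul_nonneg (hω 0) (h.gridVar_nonneg c n ω))

end IsMarket

theorem exists_pos_measure_le [IsFiniteMeasure P] {f : Ω → ℝ} (hf : Measurable f)
    (hpos : ∀ᵐ ω ∂P, 0 < f ω) {δ : ℝ≥0∞} (hδ : 0 < δ) :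
    ∃ η : ℝ, 0 < η ∧ P {ω | f ω ≤ η} ≤ δ := by
  have h1 : Tendsto (fun k : ℕ => P {ω | f ω ≤ 1 / ((k : ℝ) + 1)}) atTop
      (𝓝 (P (⋂ k : ℕ, {ω | f ω ≤ 1 / ((k : ℝ) + 1)}))) := by
    refine tendsto_measure_iInter_atTop
      (fun k => (measurableSet_le hf measurable_const).nullMeasurableSet)
      (fun k l hkl ω (hω : f ω ≤ _) => hω.trans ?_) ⟨0, measure_ne_top _ _⟩
    exact one_div_le_one_div_of_le (by positivity) (by gcongr)
  have h2 : P (⋂ k : ℕ, {ω | f ω ≤ 1 / ((k : ℝ) + 1)}) = 0 := by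
    refine measure_mono_null (fun ω hω => ?_) (ae_iff.1 hpos)
    have h3 : ∀ k : ℕ, f ω ≤ 1 / ((k : ℝ) + 1) := fun k => mem_iInter.1 hω k
    exact not_lt.2 (ge_of_tendsto' tendsto_one_div_add_atTop_nhds_zero_nat h3)
  rw [h2] at h1
  obtain ⟨k, hk⟩ := (h1.eventually (gt_mem_nhds hδ)).exists
  exact ⟨1 / ((k : ℝ) + 1), by positivity, hk.le⟩

/-- A family of variations is tight if their products with a fixed positive weight are bounded in
expectation. -/
theorem isTightFamily_of_majorant [IsFiniteMeasure P] {f : Ω → ℝ} (hf : Measurable f)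
    (hpos : ∀ᵐ ω ∂P, 0 < f ω) {I : ℝ≥0∞} (hI : I ≠ ∞) {X : Set (Ω → ℝ≥0∞)} {D : ℝ≥0∞}
    (hX : ∀ V ∈ X, ∃ R : Ω → ℝ≥0∞, Measurable R ∧
      (∀ᵐ ω ∂P, ENNReal.ofReal (f ω) * V ω ≤ D * R ω) ∧ ∫⁻ ω, R ω ∂P ≤ I) (hD : D ≠ ∞) :
    IsTightFamily P X := by
  intro δ hδ
  -- Half of δ goes to the event of small weight and half to Markov's inequality; δ may be infinite,
  -- hence the cap at 1.
  set γ : ℝ≥0∞ := min δ 1 / 2 with hγ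
  have hγ0 : 0 < γ := ENNReal.div_pos (lt_min hδ one_pos).ne' (by simp)
  have hγt : γ ≠ ∞ := ENNReal.div_ne_top (ne_top_of_le_ne_top (by simp) (min_le_right δ 1)) (by simp)
  obtain ⟨η, hη, hPη⟩ := exists_pos_measure_le hf hpos hγ0
  set a := ENNReal.ofReal η
  have ha0 : a ≠ 0 := (ENNReal.ofReal_pos.2 hη).ne'
  have hat : a ≠ ∞ := ENNReal.ofReal_ne_top
  have hγa0 : γ * a ≠ 0 := mul_ne_zero hγ0.ne' ha0
  have hγat : γ * a ≠ ∞ := ENNReal.mul_ne_top hγt hat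
  have hq : D * I / (γ * a) ≠ ∞ := ENNReal.div_ne_top (ENNReal.mul_ne_top hD hI) hγa0
  -- The added 1 keeps the level in Markov's inequality nonzero.
  set c : ℝ≥0 := (D * I / (γ * a)).toNNReal + 1 with hc
  have hc' : D * I / (γ * a) ≤ c := by
    rw [hc, ENNReal.coe_add, ENNReal.coe_toNNReal hq]
    exact le_self_add
  have hc0 : (c : ℝ≥0∞) ≠ 0 := by simp [hc]
  refine ⟨c, fun V hV => ?_⟩
  obtain ⟨R, hRm, hR, hRI⟩ := hX V hV
  have hmark : P {ω | a * c ≤ D * R ω} ≤ γ := by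
    refine (meas_ge_le_lintegral_div (hRm.const_mul D).aemeasurable (mul_ne_zero ha0 hc0)
      (ENNReal.mul_ne_top hat ENNReal.coe_ne_top)).trans ?_
    refine ENNReal.div_le_of_le_mul ?_
    rw [lintegral_const_mul _ hRm, ← mul_assoc]
    refine (mul_le_mul_right hRI D).trans ?_
    rwa [ENNReal.div_le_iff hγa0 hγat, mul_comm (c : ℝ≥0∞)] at hc'
  calc P {ω | (c : ℝ≥0∞) < V ω}
      ≤ P ({ω | f ω ≤ η} ∪ {ω | a * c ≤ D * R ω}) := by
        refine measure_mono_ae ?_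
        filter_upwards [hR] with ω h1 (h2 : _ < _)
        by_cases h3 : f ω ≤ η
        · exact Or.inl h3
        · refine Or.inr (le_trans ?_ h1)
          exact mul_le_mul' (ENNReal.ofReal_le_ofReal (not_le.1 h3).le) h2.le
    _ ≤ γ + γ := (measure_union_le _ _).trans (add_le_add hPη hmark)
    _ = min δ 1 := ENNReal.add_halves _
    _ ≤ δ := min_le_left _ _

end Market

/-! ### Tightness and the bound by the purchase price -/

section Main

variable {Ω : Type*} [mΩ : MeasurableSpace Ω] {P : Measure Ω} {T : ℝ}
  [Fact (0 < T)] {m d : ℕ} [NeZero d] {Y : Time T → Ω → EuclideanSpace ℝ (Fin m)} {ξ : Ω → ℝ}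
  {S Z B : Time T → Ω → EuclideanSpace ℝ (Fin d)}
  {K : ProperCone ℝ (EuclideanSpace ℝ (Fin d))} {ε : ℝ} {x : EuclideanSpace ℝ (Fin d)}

section

variable {𝓕 : Filtration (Time T) mΩ}

/-- The vector e₁ belongs to K, and pairing it with Z/S gives Z¹ ≥ ε|Z/S| > 0. -/
theorem ae_pos_of_mem_epsCPS (hS : IsPriceProcess P 𝓕 S) (hK : IsSolvencyCone K) (hε : 0 < ε)
    (hZ : Z ∈ epsCPS P 𝓕 K S ε) (t : Time T) : ∀ᵐ ω ∂P, 0 < Z t ω 0 := by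
  filter_upwards [hZ.2 t, hS.numeraire] with ω h1 h2
  have h3 := le_inner_of_mem_epsInterior h1.1
    (hK.orthant_subset (EuclideanSpace.single 0 1) fun i => by
      rw [PiLp.single_apply]
      split_ifs <;> norm_num)
  rw [inner_single_zero, show (quotient (Z t ω) (S t ω)) 0 = Z t ω 0 / S t ω 0 from rfl, h2 t,
    div_one] at h3
  refine lt_of_lt_of_le ?_ h3
  have : 0 < ‖quotient (Z t ω) (S t ω)‖ := norm_pos_iff.2 h1.2
  simp only [PiLp.norm_single, norm_one, mul_one]
  positivity

theorem quotient_start (hS : IsPriceProcess P 𝓕 S) :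
    ∀ᵐ ω ∂P, ∀ z, quotient z (S (startTime T) ω) = z := by
  filter_upwards [hS.initial] with ω hω z
  ext i
  simp [quotient, hω]

theorem ae_inner_start_nonneg (hS : IsPriceProcess P 𝓕 S) (hZ : Z ∈ epsCPS P 𝓕 K S ε)
    {y : EuclideanSpace ℝ (Fin d)} (hy : y ∈ K) :
    ∀ᵐ ω ∂P, 0 ≤ ⟪Z (startTime T) ω, y⟫_ℝ := by
  filter_upwards [quotient_start hS, hZ.1.mem_dual (startTime T)] with ω h1 h2
  rw [h1] at h2
  rw [real_inner_comm]
  exact mem_dualCone.1 h2.1 y hy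

variable [IsProbabilityMeasure P]

theorem integral_inner_start_le (hS : IsPriceProcess P 𝓕 S) (hZ : Z ∈ epsCPS P 𝓕 K S ε)
    (hZ0 : ∀ᵐ ω ∂P, Z (startTime T) ω 0 = 1) {y : ℝ}
    (hy : y • EuclideanSpace.single 0 (1 : ℝ) - x ∈ K) :
    ∫ ω, ⟪Z (startTime T) ω, x⟫_ℝ ∂P ≤ y := by
  calc ∫ ω, ⟪Z (startTime T) ω, x⟫_ℝ ∂P ≤ ∫ _, y ∂P := by
        refine integral_mono_ae ((hZ.1.martingale.integrable _).inner_const _)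
          (integrable_const _) ?_
        filter_upwards [ae_inner_start_nonneg hS hZ hy, hZ0] with ω h1 h2
        rw [inner_sub_right, inner_smul_right, inner_single_zero, h2] at h1
        linarith
    _ = y := by simp

end

variable [IsProbabilityMeasure P]

theorem isMarket_filtrationG (hbasis : IsBasis P Y ξ)
    (hS : IsPriceProcess P (filtrationF P Y hbasis.measurable_Y) S)
    (hZ : Z ∈ epsCPS P (filtrationF P Y hbasis.measurable_Y) K S ε)
    (hB : B ∈ admissible P (filtrationG P Y hbasis.measurable_Y ξ hbasis.measurable_ξ) K S x) :
    IsMarket P (filtrationG P Y hbasis.measurable_Y ξ hbasis.measurable_ξ) K ε S Z B x where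
  price :=
    { hS with
      adapted := fun t => (hS.adapted t).mono
        ((le_sup_left : filtrationF P Y hbasis.measurable_Y ≤
          filtrationG P Y hbasis.measurable_Y ξ hbasis.measurable_ξ) t) le_rfl }
  martingale := martingale_filtrationG hbasis hZ.1.martingale
  nonneg := hZ.1.nonneg
  mem_dual := hZ.1.mem_dual
  interior t := (hZ.2 t).mono fun _ hω _ hy => le_inner_of_mem_epsInterior hω.1 hy
  mem_admissible := hB

theorem lintegral_euclideanVar_le_purchase_div (hbasis : IsBasis P Y ξ)
    (hS : IsPriceProcess P (filtrationF P Y hbasis.measurable_Y) S) (hx : x ∈ K) (hε : 0 < ε)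
    (hZ : Z ∈ epsCPS P (filtrationF P Y hbasis.measurable_Y) K S ε)
    (hZ0 : ∀ᵐ ω ∂P, Z (startTime T) ω 0 = 1)
    (hB : B ∈ admissible P (filtrationG P Y hbasis.measurable_Y ξ hbasis.measurable_ξ) K S x) :
    ((∫⁻ ω, euclideanVar (fun t => B t ω) ∂(densityMeasure P Z) : ℝ≥0∞) : EReal) ≤
      purchase K x / (ε : EReal) := by
  obtain ⟨R, -, hR, hRI⟩ :=
    (isMarket_filtrationG hbasis hS hZ hB).exists_measurable_majorant hε hx
  have hZm : Measurable fun ω => Z (endTime T) ω 0 :=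
    measurable_coord ((hZ.1.martingale.1 (endTime T)).measurable.mono (Filtration.le _ _) le_rfl) 0
  have h1 : (∫⁻ ω, euclideanVar (fun t => B t ω) ∂(densityMeasure P Z)) * ENNReal.ofReal ε ≤
      ENNReal.ofReal (∫ ω, ⟪Z (startTime T) ω, x⟫_ℝ ∂P) := by
    rw [densityMeasure, mul_comm]
    -- This inequality requires measurability of the density only, so measurability of the variation
    -- is not needed.
    refine (mul_le_mul_right (lintegral_withDensity_le_lintegral_mul P
      hZm.ennreal_ofReal _) _).trans (le_trans ?_ hRI)
    rw [← lintegral_const_mul' _ _ ENNReal.ofReal_ne_top]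
    refine lintegral_mono_ae (hR.mono fun ω hω => ?_)
    rwa [Pi.mul_apply, ← mul_assoc, ← ENNReal.ofReal_mul hε.le]
  rw [EReal.le_div_iff_mul_le (EReal.coe_pos.2 hε) (EReal.coe_ne_top ε)]
  -- It suffices to treat each y with y e₁ - x ∈ K; if there is none, the infimum is +∞.
  refine le_sInf ?_
  rintro _ ⟨y, hy, rfl⟩
  have h2 : 0 ≤ ∫ ω, ⟪Z (startTime T) ω, x⟫_ℝ ∂P :=
    integral_nonneg_of_ae (ae_inner_start_nonneg hS hZ hx)
  have h3 := EReal.coe_ennreal_le_coe_ennreal_iff.2 h1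
  rw [EReal.coe_ennreal_mul, EReal.coe_ennreal_ofReal, EReal.coe_ennreal_ofReal,
    max_eq_left hε.le, max_eq_left h2] at h3
  exact h3.trans (EReal.coe_le_coe_iff.2 (integral_inner_start_le hS hZ hZ0 hy))

theorem isTightFamily_totalVar (hbasis : IsBasis P Y ξ)
    (hS : IsPriceProcess P (filtrationF P Y hbasis.measurable_Y) S) (hK : IsSolvencyCone K)
    (hx : x ∈ K) (hε : 0 < ε) (hZ : Z ∈ epsCPS P (filtrationF P Y hbasis.measurable_Y) K S ε) :
    IsTightFamily P
      {R | ∃ B ∈ admissible P (filtrationG P Y hbasis.measurable_Y ξ hbasis.measurable_ξ) K S x,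
        R = fun ω => totalVar fun t => B t ω} := by
  have hZm : Measurable fun ω => Z (endTime T) ω 0 :=
    measurable_coord ((hZ.1.martingale.1 (endTime T)).measurable.mono (Filtration.le _ _) le_rfl) 0
  refine isTightFamily_of_majorant (D := d) (hZm.const_mul ε)
    ((ae_pos_of_mem_epsCPS hS hK hε hZ (endTime T)).mono fun ω hω => mul_pos hε hω)
    (ENNReal.ofReal_ne_top (r := ∫ ω, ⟪Z (startTime T) ω, x⟫_ℝ ∂P)) ?_ (ENNReal.natCast_ne_top d)
  rintro _ ⟨B, hB, rfl⟩
  obtain ⟨R, hRm, hR, hRI⟩ :=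
    (isMarket_filtrationG hbasis hS hZ hB).exists_measurable_majorant hε hx
  refine ⟨R, hRm, hR.mono fun ω hω => ?_, hRI⟩
  calc _ ≤ ENNReal.ofReal (ε * Z (endTime T) ω 0) * (d * euclideanVar (B · ω)) :=
        mul_le_mul_right (totalVar_le _) _
    _ = d * (ENNReal.ofReal (ε * Z (endTime T) ω 0) * euclideanVar (B · ω)) := by ring
    _ ≤ _ := mul_le_mul_right hω _

end Main

end KabanovModel

theorem mainTheorem5 {Ω : Type*} [mΩ : MeasurableSpace Ω]
    (P : Measure Ω) [IsProbabilityMeasure P] [P.IsComplete]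
    (T : ℝ) [Fact (0 < T)] (m d : ℕ) [NeZero d]
    (Y : KabanovModel.Time T → Ω → EuclideanSpace ℝ (Fin m)) (ξ : Ω → ℝ)
    (hbasis : KabanovModel.IsBasis P Y ξ)
    (S : KabanovModel.Time T → Ω → EuclideanSpace ℝ (Fin d))
    (hS : KabanovModel.IsPriceProcess P (KabanovModel.filtrationF P Y hbasis.measurable_Y) S)
    (K : ProperCone ℝ (EuclideanSpace ℝ (Fin d))) (hK : KabanovModel.IsSolvencyCone K)
    (hCPS : ∃ ε : ℝ, 0 < ε ∧
      (KabanovModel.epsCPS P (KabanovModel.filtrationF P Y hbasis.measurable_Y) K S ε).Nonempty)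
    (x : EuclideanSpace ℝ (Fin d)) (hx : x ∈ K) :
    KabanovModel.IsTightFamily P
      {R | ∃ B ∈ KabanovModel.admissible P
          (KabanovModel.filtrationG P Y hbasis.measurable_Y ξ hbasis.measurable_ξ) K S x,
        R = fun ω => KabanovModel.totalVar fun t => B t ω} ∧
    ∀ ε : ℝ, 0 < ε →
      ∀ Z ∈ KabanovModel.epsCPS P (KabanovModel.filtrationF P Y hbasis.measurable_Y) K S ε,
      (∀ᵐ ω ∂P, Z (KabanovModel.startTime T) ω 0 = 1) →
      ∀ B ∈ KabanovModel.admissible P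
          (KabanovModel.filtrationG P Y hbasis.measurable_Y ξ hbasis.measurable_ξ) K S x,
        ((∫⁻ ω, KabanovModel.euclideanVar (fun t => B t ω)
            ∂(KabanovModel.densityMeasure P Z) : ℝ≥0∞) : EReal) ≤
          KabanovModel.purchase K x / (ε : EReal) := by
  obtain ⟨ε, hε, Z, hZ⟩ := hCPS
  exact ⟨KabanovModel.isTightFamily_totalVar hbasis hS hK hx hε hZ,
    fun ε hε Z hZ hZ0 B hB =>
      KabanovModel.lintegral_euclideanVar_le_purchase_div hbasis hS hx hε hZ hZ0 hB⟩
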